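/- Let $n\ge 1$. Cubes $Q\subset\mathbb{R}^n$ have sides parallel to the axes, and $f_Q=\frac1{|Q|}\int_Q f$. For locally integrable $f:\mathbb{R}^n\to\mathbb{R}$ put $$Mf(x)=\sup_{Q\ni x}\frac1{|Q|}\int_Q|f|,\qquad M^{\#}f(x)=\sup_{Q\ni x}\frac1{|Q|}\int_Q|f-f_Q|.$$ A weight is a nonnegative locally integrable function $w$ on $\mathbb{R}^n$ with $w(Q)=\int_Q w>0$ for every cube $Q$; its Fujii–Wilson constant is $$[w]_{A_\infty}=\sup_Q\frac1{w(Q)}\int_Q M(w\chi_Q)\,dx\in[0,\infty],$$ and $w\in A_\infty$ means $[w]_{A_\infty}<\infty$. Call $f$ admissible if it is locally integrable, not almost everywhere equal to a constant, and $Mf$ is not identically infinite. There are constants $c_n,c_n'>0$ depending only on $n$ such that the following holds for every weight $w$. (i) If $w\in A_\infty$, then for every admissible $f$, every cube $Q$ and every $1\le p<\infty$, $$\left(\frac1{w(Q)}\int_Q\left(\frac{Mf(x)-\operatorname{ess\,inf}_Q Mf}{M^{\#}f(x)}\right)^p w(x)\,dx\right)^{1/p}\le c_n\,[w]_{A_\infty}\,p.$$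 (ii) Conversely, if $0\le C<\infty$ and $$\left(\frac1{w(Q)}\int_Q\left(\frac{Mf(x)-\operatorname{ess\,inf}_Q Mf}{M^{\#}f(x)}\right)^p w(x)\,dx\right)^{1/p}\le C\,p$$ for every admissible $f$, every $1\le p<\infty$ and every cube $Q$, then $w\in A_\infty$ and $[w]_{A_\infty}\le c_n'\,C$. -/

import Mathlib

open MeasureTheory Set
open scoped ENNReal NNReal

/-- A cube of `ℝⁿ` with sides parallel to the coordinate axes. The norm of `Fin n → ℝ` is the
sup norm, so these cubes are exactly the closed balls of positive radius. -/
def IsCube {n : ℕ} (Q : Set (Fin n → ℝ)) : Prop :=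
  ∃ (a : Fin n → ℝ) (r : ℝ), 0 < r ∧ Q = Metric.closedBall a r

/-- The (non-centered) Hardy-Littlewood maximal function over cubes,
`Mf(x) = sup_{Q ∋ x} (1/|Q|) ∫_Q |f|`, with values in `[0, ∞]`. -/
noncomputable def maximalFn {n : ℕ} (f : (Fin n → ℝ) → ℝ) (x : Fin n → ℝ) : ℝ≥0∞ :=
  ⨆ (Q : Set (Fin n → ℝ)) (_ : IsCube Q) (_ : x ∈ Q),
    (volume Q)⁻¹ * ∫⁻ y in Q, ‖f y‖ₑ

/-- The Fefferman-Stein sharp maximal function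
`M^# f(x) = sup_{Q ∋ x} (1/|Q|) ∫_Q |f - f_Q|`, with `f_Q` the average of `f` over `Q`. -/
noncomputable def sharpMaximalFn {n : ℕ} (f : (Fin n → ℝ) → ℝ) (x : Fin n → ℝ) : ℝ≥0∞ :=
  ⨆ (Q : Set (Fin n → ℝ)) (_ : IsCube Q) (_ : x ∈ Q),
    (volume Q)⁻¹ * ∫⁻ y in Q, ‖f y - ⨍ z in Q, f z‖ₑ

/-- `w(Q) = ∫_Q w`. -/
noncomputable def weightMass {n : ℕ} (w : (Fin n → ℝ) → ℝ) (Q : Set (Fin n → ℝ)) : ℝ≥0∞ :=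
  ∫⁻ x in Q, ENNReal.ofReal (w x)

/-- A weight: a nonnegative locally integrable function which has positive mass on every cube
(so that the averages with respect to `w(x) dx / w(Q)` make sense). Every locally integrable
function that is positive almost everywhere is one. -/
structure IsWeight {n : ℕ} (w : (Fin n → ℝ) → ℝ) : Prop where
  locallyIntegrable : LocallyIntegrable w volume
  nonneg : ∀ᵐ x, 0 ≤ w x
  mass_pos : ∀ Q : Set (Fin n → ℝ), IsCube Q → 0 < weightMass w Q

/-- The Fujii-Wilson constant `[w]_{A_∞} = sup_Q (1/w(Q)) ∫_Q M(w χ_Q)`, in `[0, ∞]`. -/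
noncomputable def ainftyConst {n : ℕ} (w : (Fin n → ℝ) → ℝ) : ℝ≥0∞ :=
  ⨆ (Q : Set (Fin n → ℝ)) (_ : IsCube Q),
    (weightMass w Q)⁻¹ * ∫⁻ x in Q, maximalFn (Q.indicator w) x

/-- The class `A_∞`: weights with finite Fujii-Wilson constant. -/
def IsAinfty {n : ℕ} (w : (Fin n → ℝ) → ℝ) : Prop :=
  IsWeight w ∧ ainftyConst w < ∞

/-- The admissible functions: locally integrable, nonconstant (as a class modulo null sets), and
with maximal function not identically infinite. -/
structure IsAdmissible {n : ℕ} (f : (Fin n → ℝ) → ℝ) : Prop where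
  locallyIntegrable : LocallyIntegrable f volume
  nonconstant : ¬ ∃ a : ℝ, ∀ᵐ x, f x = a
  maximalFn_finite : ∃ x, maximalFn f x ≠ ∞

/-- The essential infimum over `Q` of `Mf`. -/
noncomputable def essInfMaximal {n : ℕ} (f : (Fin n → ℝ) → ℝ) (Q : Set (Fin n → ℝ)) : ℝ≥0∞ :=
  essInf (maximalFn f) (volume.restrict Q)

/-- `( (1/w(Q)) ∫_Q ( (Mf - essinf_Q Mf) / M^# f )^p w )^(1/p)`. For admissible `f`, almost
everywhere on `Q` one has `essinf_Q Mf ≤ Mf < ∞` and `0 < M^# f < ∞`, so the operations of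
`[0, ∞]` used here are the usual ones. -/
noncomputable def weightedLpRatio {n : ℕ} (w f : (Fin n → ℝ) → ℝ) (p : ℝ)
    (Q : Set (Fin n → ℝ)) : ℝ≥0∞ :=
  ((weightMass w Q)⁻¹ *
    ∫⁻ x in Q, ((maximalFn f x - essInfMaximal f Q) / sharpMaximalFn f x) ^ p *
      ENNReal.ofReal (w x)) ^ (1 / p)

/-! Both directions compare `Mf` with counting functions.

For (i), run a Calderón–Zygmund stopping procedure on the dyadic subcubes of `Q`: below a selected
cube `P`, select the maximal subcubes over which the mean of `|f - f_P|` exceeds twice the mean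
oscillation of `f` over `P`. Along dyadic cubes shrinking to `x` the mean of `|f|` then grows by at
most a multiple of `M^# f(x)` per selected cube. Any other cube around `x` is compared, after
tripling, with a dyadic cube of similar size or with `Q` itself. So `(Mf - ess inf_Q Mf) / M^# f` is
at most a dimensional multiple of `N`, the number of selected cubes containing the point
(`maximalFn_le_add_sharpMaximalFn`). On the other hand, the cubes selected below `P` fill at most
half of it, so the remainders `E_P` are disjoint and `|P| ≤ 2 |E_P|`. Hence `w(P) ≤ 2 ∫_{E_P} M(w
χ_R)` for `P ⊆ R`, and summing gives the Carleson packing bound `∑_{P ⊆ R} w(P) ≤ 2 [w] w(R)` for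
every dyadic `R` (`tsum_measure_stopSet_le`). Packing bounds the `m`-th moment of `N` by `m! (2
[w])^m w(Q)` (`lintegral_tailCount_pow_le`), whose normalized `m`-th root grows linearly in `m`.

For (ii) the case `p = 1` is enough. The test function is a discrete form of `log⁺ (M(w χ_Q) / a)`
with `a = w(Q) / |Q|`. In the spirit of Coifman and Rochberg, its mean oscillations are bounded by a
dimensional constant (`exists_avgNorm_levelCount_sub_le`), and the weak type inequality bounds `ess
inf_Q Mf`. The hypothesis therefore bounds `∫_Q f w` by `(c + c' C) w(Q)`, and an `L log L`
inequality of Stein's type (`setLIntegral_maximalFn_le`) turns this into a bound for `∫_Q M(w χ_Q)`.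
The outcome is affine in `C`; testing on indicators of small cubes bounds `C` from below
(`one_le_of_forall_weightedLpRatio_le`), which absorbs the additive constant. -/

/-- The cell of level `k` around `x`: the fiber of `φ k` through `x`. -/
def levelCell {X ι : Type*} (φ : ℕ → X → ι) (k : ℕ) (x : X) : Set X := {y | φ k y = φ k x}

/-- `G` is a union of cells of level `k`. -/
def IsSaturated {X ι : Type*} (φ : ℕ → X → ι) (k : ℕ) (G : Set X) : Prop :=
  ∀ x ∈ G, ∀ y, φ k y = φ k x → y ∈ G

/-- A refining sequence of countable measurable partitions, given by their index maps. -/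
structure IsRefining {X ι : Type*} [MeasurableSpace X] (φ : ℕ → X → ι) : Prop where
  measurable : ∀ k i, MeasurableSet (φ k ⁻¹' {i})
  refines : ∀ k x y, φ (k + 1) x = φ (k + 1) y → φ k x = φ k y

/-! ### Nested partitions and moments of counting functions under Carleson packing. -/

section Cells

variable {X ι : Type*} {φ : ℕ → X → ι}

lemma mem_levelCell_self (k : ℕ) (x : X) : x ∈ levelCell φ k x := rfl

lemma levelCell_eq_of_mem {k : ℕ} {x y : X} (h : y ∈ levelCell φ k x) :
    levelCell φ k y = levelCell φ k x := by
  ext z; simp only [levelCell, mem_ofPred_eq] at *; rw [h]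

lemma IsSaturated.inter {k : ℕ} {G H : Set X} (hG : IsSaturated φ k G) (hH : IsSaturated φ k H) :
    IsSaturated φ k (G ∩ H) := fun x hx y hy => ⟨hG x hx.1 y hy, hH x hx.2 y hy⟩

lemma IsSaturated.eq_iUnion {k : ℕ} {G : Set X} (hG : IsSaturated φ k G) :
    G = ⋃ i : φ k '' G, φ k ⁻¹' {i.1} := by
  ext x
  simp only [mem_iUnion, mem_preimage, mem_singleton_iff, Subtype.exists, mem_image, exists_prop]
  constructor
  · exact fun hx => ⟨φ k x, ⟨x, hx, rfl⟩, rfl⟩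
  · rintro ⟨i, ⟨y, hy, rfl⟩, hx⟩
    exact hG y hy x hx

/-- The number of the sets `D k, D (k + 1), …` that contain a point. -/
noncomputable def tailCount (D : ℕ → Set X) (k : ℕ) (y : X) : ℝ≥0∞ :=
  ∑' j, (D (k + j)).indicator 1 y

lemma tailCount_eq_add (D : ℕ → Set X) (k : ℕ) (y : X) :
    tailCount D k y = (D k).indicator 1 y + tailCount D (k + 1) y := by
  unfold tailCount
  rw [tsum_eq_zero_add' ENNReal.summable]
  simp only [add_zero, add_assoc, add_comm 1]

/-- A subtraction-free form of `u^(m+1) - b^(m+1) ≤ (m+1) (u - b) u^m` with `u = a + b`. Taking `b`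
to be the next tail count makes powers of tail counts telescope. -/
lemma ENNReal.add_pow_succ_le (a b : ℝ≥0∞) (m : ℕ) :
    (a + b) ^ (m + 1) ≤ (m + 1 : ℕ) * (a * (a + b) ^ m) + b ^ (m + 1) := by
  induction m with
  | zero => simp
  | succ m ih =>
    calc (a + b) ^ (m + 2) = a * (a + b) ^ (m + 1) + b * (a + b) ^ (m + 1) := by ring
      _ ≤ a * (a + b) ^ (m + 1) + b * ((m + 1 : ℕ) * (a * (a + b) ^ m) + b ^ (m + 1)) := by gcongr
      _ = a * (a + b) ^ (m + 1) + (m + 1 : ℕ) * (a * (b * (a + b) ^ m)) + b ^ (m + 2) := by ring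
      _ ≤ a * (a + b) ^ (m + 1) + (m + 1 : ℕ) * (a * ((a + b) * (a + b) ^ m)) + b ^ (m + 2) := by
        gcongr; exact le_add_self
      _ = _ := by push_cast; ring

lemma tailCount_pow_le_sum (D : ℕ → Set X) (k m J : ℕ) (y : X) :
    tailCount D k y ^ (m + 1) ≤
      (∑ j ∈ Finset.range J,
        (m + 1 : ℕ) * ((D (k + j)).indicator 1 y * tailCount D (k + j) y ^ m)) +
        tailCount D (k + J) y ^ (m + 1) := by
  induction J with
  | zero => simp
  | succ J ih =>
    refine ih.trans ?_
    rw [Finset.sum_range_succ, add_assoc]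
    gcongr
    rw [tailCount_eq_add D (k + J)]
    exact ENNReal.add_pow_succ_le _ _ m

/-- The telescoped bound in the limit: a finite tail count tends to zero. If the tail count is
infinite, so are all later ones, and the right side is infinite too. -/
lemma tailCount_pow_le_tsum (D : ℕ → Set X) (k m : ℕ) (y : X) :
    tailCount D k y ^ (m + 1) ≤
      ∑' j, (m + 1 : ℕ) * ((D (k + j)).indicator 1 y * tailCount D (k + j) y ^ m) := by
  by_cases htop : tailCount D k y = ∞
  · have hj : ∀ j, tailCount D (k + j) y = ∞ := by
      intro j
      induction j with
      | zero => exact htop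
      | succ j ih =>
        rw [tailCount_eq_add] at ih
        refine (ENNReal.add_eq_top.1 ih).resolve_left ?_
        by_cases h : y ∈ D (k + j) <;> simp [h]
    rcases Nat.eq_zero_or_pos m with rfl | hm
    · simp [tailCount]
    · obtain ⟨j, hyj⟩ : ∃ j, y ∈ D (k + j) := by
        by_contra! hno
        simp [tailCount, hno] at htop
      refine le_trans ?_ (ENNReal.le_tsum j)
      simp [hj, hyj, hm.ne']
  · have hlim : Filter.Tendsto (fun J => tailCount D (k + J) y) Filter.atTop (nhds 0) := by
      have := ENNReal.tendsto_sum_nat_add (fun j => (D (k + j)).indicator (1 : X → ℝ≥0∞) y) htop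
      refine this.congr fun J => ?_
      unfold tailCount
      congr 1; ext j
      rw [add_assoc, add_comm J j]
    have hlim2 : Filter.Tendsto (fun J => (∑' j, (m + 1 : ℕ) *
        ((D (k + j)).indicator 1 y * tailCount D (k + j) y ^ m)) + tailCount D (k + J) y ^ (m + 1))
        Filter.atTop (nhds ((∑' j, (m + 1 : ℕ) *
        ((D (k + j)).indicator 1 y * tailCount D (k + j) y ^ m)) + 0)) := by
      refine tendsto_const_nhds.add ?_
      have := (ENNReal.continuous_pow (m + 1)).tendsto 0 |>.comp hlim
      rw [zero_pow m.succ_ne_zero] at this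
      exact this
    rw [add_zero] at hlim2
    refine ge_of_tendsto' hlim2 fun J => ?_
    refine (tailCount_pow_le_sum D k m J y).trans ?_
    gcongr
    exact ENNReal.sum_le_tsum _

variable [MeasurableSpace X]

lemma IsRefining.eq_of_le (hφ : IsRefining φ) {k l : ℕ} (hkl : k ≤ l) {x y : X}
    (h : φ l x = φ l y) : φ k x = φ k y := by
  induction l, hkl using Nat.le_induction with
  | base => exact h
  | succ l _ ih => exact ih (hφ.refines l x y h)

lemma IsRefining.levelCell_subset (hφ : IsRefining φ) {k l : ℕ} (hkl : k ≤ l) (x : X) :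
    levelCell φ l x ⊆ levelCell φ k x := fun _ hy => hφ.eq_of_le hkl hy

lemma IsRefining.isSaturated_levelCell (hφ : IsRefining φ) {k l : ℕ} (hkl : k ≤ l) (x : X) :
    IsSaturated φ l (levelCell φ k x) := fun y hy z hz => by
  have := hφ.eq_of_le hkl hz
  simp only [levelCell, mem_ofPred_eq] at *
  rw [this, hy]

lemma IsRefining.measurableSet_levelCell (hφ : IsRefining φ) (k : ℕ) (x : X) :
    MeasurableSet (levelCell φ k x) := hφ.measurable k (φ k x)

lemma IsSaturated.measurableSet [Countable ι] (hφ : IsRefining φ) {k : ℕ} {G : Set X}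
    (hG : IsSaturated φ k G) : MeasurableSet G := by
  rw [hG.eq_iUnion]
  exact MeasurableSet.iUnion fun i => hφ.measurable k i.1

/-- An inequality between integrals may be checked cell by cell. -/
lemma IsSaturated.lintegral_le [Countable ι] (hφ : IsRefining φ) {k : ℕ} {G : Set X}
    (hG : IsSaturated φ k G) {μ ν : Measure X} {u v : X → ℝ≥0∞} {c : ℝ≥0∞}
    (h : ∀ x ∈ G, ∫⁻ y in levelCell φ k x, u y ∂μ ≤ c * ∫⁻ y in levelCell φ k x, v y ∂ν) :
    ∫⁻ y in G, u y ∂μ ≤ c * ∫⁻ y in G, v y ∂ν := by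
  have hd : Pairwise (Function.onFun Disjoint fun i : φ k '' G => φ k ⁻¹' {i.1}) := by
    intro i j hij
    refine Disjoint.preimage _ ?_
    simpa [Subtype.ext_iff] using hij
  rw [hG.eq_iUnion, lintegral_iUnion (fun i : φ k '' G => hφ.measurable k i.1) hd,
    lintegral_iUnion (fun i : φ k '' G => hφ.measurable k i.1) hd, ← ENNReal.tsum_mul_left]
  refine ENNReal.tsum_le_tsum ?_
  rintro ⟨_, x, hx, rfl⟩
  exact h x hx

lemma measurable_tailCount {D : ℕ → Set X} (hD : ∀ k, MeasurableSet (D k)) (k : ℕ) :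
    Measurable (tailCount D k) :=
  Measurable.tsum fun j => measurable_one.indicator (hD (k + j))

/-- Moments of the counting function of a family of cells with the Carleson packing property. -/
lemma lintegral_tailCount_pow_le [Countable ι] (hφ : IsRefining φ) {μ : Measure X} {Λ : ℝ≥0∞}
    {D : ℕ → Set X} (hD : ∀ k, IsSaturated φ k (D k))
    (hpack : ∀ k x, ∑' j, μ (D (k + j) ∩ levelCell φ k x) ≤ Λ * μ (levelCell φ k x))
    (m k : ℕ) (x : X) :
    ∫⁻ y in levelCell φ k x, tailCount D k y ^ m ∂μ ≤
      m.factorial * Λ ^ m * μ (levelCell φ k x) := by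
  induction m generalizing k x with
  | zero => simp
  | succ m ih =>
    have hDm : ∀ k, MeasurableSet (D k) := fun k => (hD k).measurableSet hφ
    have hterm : ∀ j, ∫⁻ y in levelCell φ k x,
        (m + 1 : ℕ) * ((D (k + j)).indicator 1 y * tailCount D (k + j) y ^ m) ∂μ ≤
        (m + 1 : ℕ) * (m.factorial * Λ ^ m * μ (D (k + j) ∩ levelCell φ k x)) := by
      intro j
      rw [lintegral_const_mul' _ _ (by simp)]
      gcongr
      have : ∀ y, (D (k + j)).indicator (1 : X → ℝ≥0∞) y * tailCount D (k + j) y ^ m =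
          (D (k + j)).indicator (fun y => tailCount D (k + j) y ^ m) y := by
        intro y; by_cases h : y ∈ D (k + j) <;> simp [h]
      simp_rw [this]
      rw [lintegral_indicator (hDm _), Measure.restrict_restrict (hDm _)]
      -- `D (k + j)` within the given cell is a union of cells of level `k + j`; the induction
      -- hypothesis applies to each of them separately.
      have hsat := (hD (k + j)).inter (hφ.isSaturated_levelCell (Nat.le_add_right k j) x)
      have := hsat.lintegral_le hφ (μ := μ) (ν := μ) (u := fun y => tailCount D (k + j) y ^ m)
        (v := fun _ => 1) (c := m.factorial * Λ ^ m) (fun z _ => by simpa using ih (k + j) z)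
      simpa using this
    calc ∫⁻ y in levelCell φ k x, tailCount D k y ^ (m + 1) ∂μ
        ≤ ∫⁻ y in levelCell φ k x, ∑' j, (m + 1 : ℕ) *
            ((D (k + j)).indicator 1 y * tailCount D (k + j) y ^ m) ∂μ :=
          lintegral_mono fun y => tailCount_pow_le_tsum D k m y
      _ = ∑' j, ∫⁻ y in levelCell φ k x, (m + 1 : ℕ) *
            ((D (k + j)).indicator 1 y * tailCount D (k + j) y ^ m) ∂μ := by
          refine lintegral_tsum fun j => Measurable.aemeasurable ?_
          exact ((measurable_one.indicator (hDm _)).mul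
            ((measurable_tailCount hDm _).pow_const m)).const_mul _
      _ ≤ ∑' j, (m + 1 : ℕ) * (m.factorial * Λ ^ m * μ (D (k + j) ∩ levelCell φ k x)) :=
          ENNReal.tsum_le_tsum hterm
      _ = (m + 1 : ℕ) * (m.factorial * Λ ^ m * ∑' j, μ (D (k + j) ∩ levelCell φ k x)) := by
          rw [ENNReal.tsum_mul_left, ENNReal.tsum_mul_left]
      _ ≤ (m + 1 : ℕ) * (m.factorial * Λ ^ m * (Λ * μ (levelCell φ k x))) := by
          gcongr; exact hpack k x
      _ = _ := by rw [Nat.factorial_succ]; push_cast; ring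

end Cells

/-! ### Comparison of means over nested sets through the oscillation. -/

section Averages

variable {X : Type*} [MeasurableSpace X] {μ : Measure X} {f : X → ℝ} {R S : Set X} {κ : ℝ≥0∞}

/-- The mean of `|f|` over `S`. -/
noncomputable def avgNorm (μ : Measure X) (f : X → ℝ) (S : Set X) : ℝ≥0∞ :=
  (μ S)⁻¹ * ∫⁻ y in S, ‖f y‖ₑ ∂μ

/-- The mean oscillation of `f` over `S`. -/
noncomputable def meanOsc (μ : Measure X) (f : X → ℝ) (S : Set X) : ℝ≥0∞ :=
  (μ S)⁻¹ * ∫⁻ y in S, ‖f y - ⨍ z in S, f z ∂μ‖ₑ ∂μ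

lemma avgNorm_congr_set (h : R =ᵐ[μ] S) : avgNorm μ f R = avgNorm μ f S := by
  simp only [avgNorm, Measure.restrict_congr_set h, measure_congr h]

lemma meanOsc_congr_set (h : R =ᵐ[μ] S) : meanOsc μ f R = meanOsc μ f S := by
  simp only [meanOsc, Measure.restrict_congr_set h, measure_congr h]

lemma enorm_setAverage_le_avgNorm (f : X → ℝ) (h0 : μ S ≠ 0) (htop : μ S ≠ ∞) :
    ‖⨍ z in S, f z ∂μ‖ₑ ≤ avgNorm μ f S := by
  rw [setAverage_eq, enorm_smul, avgNorm]
  gcongr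
  · rw [Measure.real, enorm_inv (ENNReal.toReal_ne_zero.2 ⟨h0, htop⟩),
      Real.enorm_of_nonneg ENNReal.toReal_nonneg, ENNReal.ofReal_toReal htop]
  · exact enorm_integral_le_lintegral_enorm _

lemma avgNorm_le_add_enorm (f : X → ℝ) (S : Set X) (c : ℝ) :
    avgNorm μ f S ≤ (μ S)⁻¹ * ∫⁻ y in S, ‖f y - c‖ₑ ∂μ + ‖c‖ₑ := by
  calc avgNorm μ f S ≤ (μ S)⁻¹ * (∫⁻ y in S, (‖f y - c‖ₑ + ‖c‖ₑ) ∂μ) := by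
        unfold avgNorm
        gcongr with y
        calc ‖f y‖ₑ = ‖(f y - c) + c‖ₑ := by simp
          _ ≤ _ := enorm_add_le _ _
    _ = (μ S)⁻¹ * ∫⁻ y in S, ‖f y - c‖ₑ ∂μ + (μ S)⁻¹ * μ S * ‖c‖ₑ := by
        rw [lintegral_add_right _ measurable_const, setLIntegral_const]; ring
    _ ≤ (μ S)⁻¹ * ∫⁻ y in S, ‖f y - c‖ₑ ∂μ + 1 * ‖c‖ₑ := by
        gcongr; exact ENNReal.inv_mul_le_one _
    _ = _ := by rw [one_mul]

lemma enorm_le_avgNorm_add (hf : AEStronglyMeasurable f μ) (h0 : μ S ≠ 0) (htop : μ S ≠ ∞)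
    (c : ℝ) : ‖c‖ₑ ≤ avgNorm μ f S + (μ S)⁻¹ * ∫⁻ y in S, ‖f y - c‖ₑ ∂μ := by
  calc ‖c‖ₑ = (μ S)⁻¹ * ∫⁻ _ in S, ‖c‖ₑ ∂μ := by
        rw [setLIntegral_const, mul_comm ‖c‖ₑ, ← mul_assoc, ENNReal.inv_mul_cancel h0 htop, one_mul]
    _ ≤ (μ S)⁻¹ * ∫⁻ y in S, (‖f y‖ₑ + ‖f y - c‖ₑ) ∂μ := by
        gcongr with y
        calc ‖c‖ₑ = ‖f y - (f y - c)‖ₑ := by simp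
          _ ≤ _ := enorm_sub_le
    _ = _ := by
        rw [lintegral_add_left' hf.restrict.enorm, mul_add, avgNorm]

lemma inv_mul_lintegral_le_of_subset (hSR : S ⊆ R) (h0 : μ S ≠ 0) (htop : μ R ≠ ∞)
    (hκ : μ R ≤ κ * μ S) (g : X → ℝ≥0∞) :
    (μ S)⁻¹ * ∫⁻ y in S, g y ∂μ ≤ κ * ((μ R)⁻¹ * ∫⁻ y in R, g y ∂μ) := by
  have hS : μ S ≠ ∞ := ne_top_of_le_ne_top htop (measure_mono hSR)
  have hR : μ R ≠ 0 := fun h => h0 (measure_mono_null hSR h)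
  have : (μ S)⁻¹ ≤ κ * (μ R)⁻¹ := by
    rw [ENNReal.inv_le_iff_le_mul (fun _ => by simpa using h0) (fun h => absurd h hS)] 
    calc (1 : ℝ≥0∞) = μ R * (μ R)⁻¹ := (ENNReal.mul_inv_cancel hR htop).symm
      _ ≤ (κ * μ S) * (μ R)⁻¹ := by gcongr
      _ = _ := by ring
  rw [← mul_assoc]
  gcongr

lemma avgNorm_le_of_subset (f : X → ℝ) (hSR : S ⊆ R) (h0 : μ S ≠ 0)
    (htop : μ R ≠ ∞) (hκ : μ R ≤ κ * μ S) :
    avgNorm μ f S ≤ avgNorm μ f R + κ * meanOsc μ f R := by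
  have hR : μ R ≠ 0 := fun h => h0 (measure_mono_null hSR h)
  refine (avgNorm_le_add_enorm f S (⨍ z in R, f z ∂μ)).trans ?_
  rw [add_comm]
  exact add_le_add (enorm_setAverage_le_avgNorm f hR htop)
    (inv_mul_lintegral_le_of_subset hSR h0 htop hκ _)

/-- The mean `f_R` is the pivot: it is close to the values of `f` on average over `R`, and over `S`
as well at the cost of the factor `κ`. -/
lemma avgNorm_le_of_superset (hf : AEStronglyMeasurable f μ) (hSR : S ⊆ R) (h0 : μ S ≠ 0)
    (htop : μ R ≠ ∞) (hκ : μ R ≤ κ * μ S) :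
    avgNorm μ f R ≤ avgNorm μ f S + (κ + 1) * meanOsc μ f R := by
  have hS : μ S ≠ ∞ := ne_top_of_le_ne_top htop (measure_mono hSR)
  calc avgNorm μ f R ≤ meanOsc μ f R + ‖⨍ z in R, f z ∂μ‖ₑ := avgNorm_le_add_enorm f R _
    _ ≤ meanOsc μ f R + (avgNorm μ f S + κ * meanOsc μ f R) := by
        gcongr
        exact (enorm_le_avgNorm_add hf h0 hS _).trans
          (add_le_add_right (inv_mul_lintegral_le_of_subset hSR h0 htop hκ _) _)
    _ = _ := by ring

end Averages

/-! ### The stopping procedure: packing of the selected cells and growth of means. -/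

section Stopping

variable {X ι : Type*} [MeasurableSpace X]

/-- The integral over the cell of level `k` around `x` of the deviation of `f` from its mean over
the cell of level `i`. -/
noncomputable def cellDev (μ : Measure X) (φ : ℕ → X → ι) (f : X → ℝ) (i k : ℕ) (x : X) : ℝ≥0∞ :=
  ∫⁻ y in levelCell φ k x, ‖f y - ⨍ z in levelCell φ i x, f z ∂μ‖ₑ ∂μ

open Classical in
/-- The last level up to `k` at which the Calderón-Zygmund stopping procedure, applied to the cells
around `x`, selects a cell: a new cell is selected once the mean deviation of `f` from its average
over the last selected cell is more than twice the mean oscillation over that cell. -/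
noncomputable def stopLevel (μ : Measure X) (φ : ℕ → X → ι) (f : X → ℝ) : ℕ → X → ℕ
  | 0, _ => 0
  | k + 1, x =>
    -- The comparison of the two means, with denominators cleared.
    if 2 * cellDev μ φ f (stopLevel μ φ f k x) (stopLevel μ φ f k x) x * μ (levelCell φ (k + 1) x) <
        μ (levelCell φ (stopLevel μ φ f k x) x) * cellDev μ φ f (stopLevel μ φ f k x) (k + 1) x
    then k + 1 else stopLevel μ φ f k x

/-- The union of the selected cells of level `k`. -/
def stopSet (μ : Measure X) (φ : ℕ → X → ι) (f : X → ℝ) (k : ℕ) : Set X :=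
  {x | stopLevel μ φ f k x = k}

/-- The points for which no cell is selected after level `k`. -/
def lastStopSet (μ : Measure X) (φ : ℕ → X → ι) (f : X → ℝ) (k : ℕ) : Set X :=
  {x | ∀ l, k ≤ l → stopLevel μ φ f l x = k}

variable {μ : Measure X} {φ : ℕ → X → ι} {f : X → ℝ}

lemma stopLevel_le (k : ℕ) (x : X) : stopLevel μ φ f k x ≤ k := by
  induction k with
  | zero => rfl
  | succ k ih => rw [stopLevel]; split_ifs <;> lia

lemma stopLevel_succ_eq_or (k : ℕ) (x : X) :
    stopLevel μ φ f (k + 1) x = k + 1 ∨ stopLevel μ φ f (k + 1) x = stopLevel μ φ f k x := by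
  rw [stopLevel]; split_ifs <;> simp

lemma stopLevel_eq_of_le {k l l' : ℕ} {x : X} (h : stopLevel μ φ f l x = k) (hk : k ≤ l')
    (hl : l' ≤ l) : stopLevel μ φ f l' x = k := by
  induction l, hl using Nat.le_induction with
  | base => exact h
  | succ l hl ih =>
    rcases stopLevel_succ_eq_or (μ := μ) (φ := φ) (f := f) l x with h' | h'
    · lia
    · exact ih (h' ▸ h)

lemma cellDev_congr (hφ : IsRefining φ) {i k : ℕ} (hik : i ≤ k) {x y : X} (h : φ k x = φ k y) :
    cellDev μ φ f i k x = cellDev μ φ f i k y := by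
  rw [cellDev, cellDev, levelCell_eq_of_mem (φ := φ) (k := k) (x := y) (y := x) h,
    levelCell_eq_of_mem (φ := φ) (k := i) (x := y) (y := x) (hφ.eq_of_le hik h)]

lemma stopLevel_congr (hφ : IsRefining φ) {k : ℕ} {x y : X} (h : φ k x = φ k y) :
    stopLevel μ φ f k x = stopLevel μ φ f k y := by
  induction k with
  | zero => rfl
  | succ k ih =>
    have hk := hφ.refines k x y h
    have hle := stopLevel_le (μ := μ) (φ := φ) (f := f) k y
    have hs := hφ.eq_of_le hle hk
    rw [stopLevel, stopLevel, ih hk, cellDev_congr hφ le_rfl hs, cellDev_congr hφ (by lia) h,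
      levelCell_eq_of_mem (φ := φ) (k := k + 1) (x := y) (y := x) h,
      levelCell_eq_of_mem (φ := φ) (x := y) (y := x) hs]

lemma isSaturated_stopSet (hφ : IsRefining φ) (k : ℕ) : IsSaturated φ k (stopSet μ φ f k) :=
  fun _ hx _ hy => (stopLevel_congr hφ hy).trans hx

lemma isSaturated_stopLevel (hφ : IsRefining φ) (k j : ℕ) :
    IsSaturated φ k {x | stopLevel μ φ f k x = j} :=
  fun _ hx _ hy => (stopLevel_congr hφ hy).trans hx

lemma lastStopSet_eq_iInter (k : ℕ) :
    lastStopSet μ φ f k = ⋂ l, ⋂ (_ : k ≤ l), {x | stopLevel μ φ f l x = k} := by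
  ext; simp [lastStopSet]

lemma measurableSet_lastStopSet [Countable ι] (hφ : IsRefining φ) (k : ℕ) :
    MeasurableSet (lastStopSet μ φ f k) := by
  rw [lastStopSet_eq_iInter]
  exact MeasurableSet.iInter fun l => MeasurableSet.iInter fun _ =>
    (isSaturated_stopLevel hφ l k).measurableSet hφ

lemma disjoint_lastStopSet : Pairwise (Function.onFun Disjoint (lastStopSet μ φ f)) := by
  intro k l hkl
  refine Set.disjoint_left.2 fun x hk hl => hkl ?_
  exact (hk (max k l) (le_max_left _ _)).symm.trans (hl (max k l) (le_max_right _ _))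

/-- The points whose first selected cell after level `k` has level `l + 1`. -/
def departSet (μ : Measure X) (φ : ℕ → X → ι) (f : X → ℝ) (k l : ℕ) : Set X :=
  {x | k ≤ l ∧ stopLevel μ φ f l x = k ∧ stopLevel μ φ f (l + 1) x = l + 1}

lemma isSaturated_departSet (hφ : IsRefining φ) (k l : ℕ) :
    IsSaturated φ (l + 1) (departSet μ φ f k l) :=
  fun _ hx _ hy => ⟨hx.1, (stopLevel_congr hφ (hφ.refines _ _ _ hy)).trans hx.2.1,
    (stopLevel_congr hφ hy).trans hx.2.2⟩

lemma disjoint_departSet (k : ℕ) : Pairwise (Function.onFun Disjoint (departSet μ φ f k)) := by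
  have key : ∀ l l' x, l < l' → x ∈ departSet μ φ f k l → x ∉ departSet μ φ f k l' := by
    intro l l' x hl hx hx'
    have := stopLevel_eq_of_le hx'.2.1 (hx.1.trans (Nat.le_succ l)) hl
    have h1 := hx.2.2
    have h2 := hx.1
    lia
  intro l l' hne
  refine Set.disjoint_left.2 fun x hx hx' => ?_
  rcases lt_or_gt_of_ne hne with h | h
  · exact key _ _ x h hx hx'
  · exact key _ _ x h hx' hx

lemma mem_lastStopSet_of_forall_notMem {k : ℕ} {x : X} (hx : x ∈ stopSet μ φ f k)
    (h : ∀ l, x ∉ departSet μ φ f k l) : x ∈ lastStopSet μ φ f k := by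
  intro l hl
  induction l, hl using Nat.le_induction with
  | base => exact hx
  | succ l hl ih =>
    rcases stopLevel_succ_eq_or (μ := μ) (φ := φ) (f := f) l x with h' | h'
    · exact absurd ⟨hl, ih, h'⟩ (h l)
    · exact h'.trans ih

lemma lt_of_mem_departSet {k l : ℕ} {x : X} (hx : x ∈ departSet μ φ f k l) :
    2 * cellDev μ φ f k k x * μ (levelCell φ (l + 1) x) <
      μ (levelCell φ k x) * cellDev μ φ f k (l + 1) x := by
  by_contra hno
  have h2 := hx.2.2
  rw [stopLevel, hx.2.1, if_neg hno] at h2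
  have := hx.1
  lia

/-- At least half of a selected cell is not covered by cells selected later. -/
lemma measure_levelCell_le_lastStopSet [Countable ι] (hφ : IsRefining φ) {k : ℕ} {x : X}
    (hx : x ∈ stopSet μ φ f k) (htop : μ (levelCell φ k x) ≠ ∞)
    (hdev : cellDev μ φ f k k x ≠ ∞) :
    μ (levelCell φ k x) ≤ 2 * μ (levelCell φ k x ∩ lastStopSet μ φ f k) := by
  set P := levelCell φ k x with hP
  set I := cellDev μ φ f k k x with hI
  set c := ⨍ z in P, f z ∂μ with hc
  have hPm : MeasurableSet P := hφ.measurableSet_levelCell k x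
  have hGm : ∀ l, MeasurableSet (P ∩ departSet μ φ f k l) := fun l =>
    hPm.inter ((isSaturated_departSet hφ k l).measurableSet hφ)
  have hcell : ∀ y ∈ P, levelCell φ k y = P := fun y hy => levelCell_eq_of_mem hy
  have hdevy : ∀ y ∈ P, ∀ l, cellDev μ φ f k l y = ∫⁻ z in levelCell φ l y, ‖f z - c‖ₑ ∂μ :=
    fun y hy l => by rw [cellDev, hcell y hy]
  have hdisj : Pairwise (Function.onFun Disjoint fun l => P ∩ departSet μ φ f k l) := fun l l' h =>
    (disjoint_departSet k h).mono inter_subset_right inter_subset_right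
  have hG : 2 * I * μ (⋃ l, P ∩ departSet μ φ f k l) ≤ μ P * I := by
    -- Chebyshev's argument: on each newly selected cell the stopping inequality bounds its measure
    -- by the integral of the deviation, and these cells are disjoint.
    have hl : ∀ l, ∫⁻ _ in P ∩ departSet μ φ f k l, 2 * I ∂μ ≤
        μ P * ∫⁻ y in P ∩ departSet μ φ f k l, ‖f y - c‖ₑ ∂μ := by
      intro l
      by_cases hkl : k ≤ l
      · have hs := (hφ.isSaturated_levelCell (hkl.trans (Nat.le_succ l)) x).inter
          (isSaturated_departSet (μ := μ) (f := f) hφ k l)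
        refine hs.lintegral_le hφ fun y hy => ?_
        have := (lt_of_mem_departSet hy.2).le
        rw [hcell y hy.1, hdevy y hy.1, hdevy y hy.1, hcell y hy.1] at this
        rw [setLIntegral_const]
        exact this
      · have : departSet μ φ f k l = ∅ := by
          ext y; simp [departSet, hkl]
        simp [this]
    calc 2 * I * μ (⋃ l, P ∩ departSet μ φ f k l)
        = ∫⁻ _ in ⋃ l, P ∩ departSet μ φ f k l, 2 * I ∂μ := by rw [setLIntegral_const]
      _ = ∑' l, ∫⁻ _ in P ∩ departSet μ φ f k l, 2 * I ∂μ := lintegral_iUnion hGm hdisj _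
      _ ≤ ∑' l, μ P * ∫⁻ y in P ∩ departSet μ φ f k l, ‖f y - c‖ₑ ∂μ := ENNReal.tsum_le_tsum hl
      _ = μ P * ∫⁻ y in ⋃ l, P ∩ departSet μ φ f k l, ‖f y - c‖ₑ ∂μ := by
          rw [ENNReal.tsum_mul_left, lintegral_iUnion hGm hdisj]
      _ ≤ μ P * I := by
          gcongr
          exact lintegral_mono_set (iUnion_subset fun l => inter_subset_left)
  have hhalf : 2 * μ (⋃ l, P ∩ departSet μ φ f k l) ≤ μ P := by
    -- The factor `I` is to be cancelled. When it vanishes, the deviation vanishes on all subcells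
    -- and the strict stopping inequality never holds.
    by_cases hI0 : I = 0
    · have : ∀ l, P ∩ departSet μ φ f k l = ∅ := by
        intro l
        refine eq_empty_of_forall_notMem fun y hy => ?_
        have h1 := lt_of_mem_departSet hy.2
        have h2 : cellDev μ φ f k (l + 1) y ≤ I := by
          rw [hdevy y hy.1]
          refine lintegral_mono_set ?_
          have := hφ.levelCell_subset (hy.2.1.trans (Nat.le_succ l)) y
          rwa [hcell y hy.1] at this
        rw [hI0, nonpos_iff_eq_zero] at h2
        rw [h2] at h1
        simp at h1
      simp [this]
    · have : I * (2 * μ (⋃ l, P ∩ departSet μ φ f k l)) ≤ I * μ P := by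
        calc _ = 2 * I * μ (⋃ l, P ∩ departSet μ φ f k l) := by ring
          _ ≤ _ := hG
          _ = _ := mul_comm _ _
      exact (ENNReal.mul_le_mul_iff_right hI0 hdev).1 this
  have hcover : P ⊆ (P ∩ lastStopSet μ φ f k) ∪ ⋃ l, P ∩ departSet μ φ f k l := by
    intro y hy
    by_cases h : ∃ l, y ∈ departSet μ φ f k l
    · obtain ⟨l, hl⟩ := h
      exact Or.inr (mem_iUnion.2 ⟨l, hy, hl⟩)
    · push Not at h
      exact Or.inl ⟨hy, mem_lastStopSet_of_forall_notMem
        (isSaturated_stopSet hφ k x hx y hy) h⟩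
  have h1 : μ P ≤ μ (P ∩ lastStopSet μ φ f k) + μ (⋃ l, P ∩ departSet μ φ f k l) :=
    (measure_mono hcover).trans (measure_union_le _ _)
  have h2 : μ P + μ P ≤ μ P + 2 * μ (P ∩ lastStopSet μ φ f k) := by
    calc μ P + μ P = 2 * μ P := (two_mul _).symm
      _ ≤ 2 * (μ (P ∩ lastStopSet μ φ f k) + μ (⋃ l, P ∩ departSet μ φ f k l)) := by gcongr
      _ = 2 * μ (P ∩ lastStopSet μ φ f k) + 2 * μ (⋃ l, P ∩ departSet μ φ f k l) := by ring
      _ ≤ 2 * μ (P ∩ lastStopSet μ φ f k) + μ P := by gcongr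
      _ = _ := add_comm _ _
  exact (ENNReal.add_le_add_iff_left htop).1 h2

/-- The selected cells have the Carleson packing property with respect to a measure `ν` whose means
over cells are controlled by a function with small integral. -/
lemma tsum_measure_stopSet_le [Countable ι] (hφ : IsRefining φ) {ν : Measure X} {k : ℕ} {x : X}
    (h0 : ∀ l y, μ (levelCell φ l y) ≠ 0) (htop : ∀ l y, μ (levelCell φ l y) ≠ ∞)
    (hdev : ∀ l y, y ∈ stopSet μ φ f l → cellDev μ φ f l l y ≠ ∞) {g : X → ℝ≥0∞}
    (hg : ∀ l, k ≤ l → ∀ y ∈ levelCell φ k x, ∀ z ∈ levelCell φ l y,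
      (μ (levelCell φ l y))⁻¹ * ν (levelCell φ l y) ≤ g z) :
    ∑' j, ν (stopSet μ φ f (k + j) ∩ levelCell φ k x) ≤ 2 * ∫⁻ y in levelCell φ k x, g y ∂μ := by
  have hterm : ∀ j, ν (stopSet μ φ f (k + j) ∩ levelCell φ k x) ≤
      2 * ∫⁻ y in levelCell φ k x ∩ lastStopSet μ φ f (k + j), g y ∂μ := by
    intro j
    set l := k + j with hl
    have hkl : k ≤ l := Nat.le_add_right k j
    have hsat := (isSaturated_stopSet (μ := μ) (f := f) hφ l).inter (hφ.isSaturated_levelCell hkl x)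
    have hFm := measurableSet_lastStopSet (μ := μ) (f := f) hφ l
    have := hsat.lintegral_le hφ (μ := ν) (ν := μ) (u := fun _ => 1)
      (v := (lastStopSet μ φ f l).indicator g) (c := 2) ?_
    · rw [setLIntegral_one] at this
      refine this.trans ?_
      rw [setLIntegral_indicator hFm]
      gcongr 2 * ?_
      exact lintegral_mono_set fun y hy => ⟨hy.2.2, hy.1⟩
    · rintro y ⟨hyD, hyP⟩
      set P := levelCell φ l y with hP
      rw [setLIntegral_one, setLIntegral_indicator hFm, inter_comm]
      have hhalf := measure_levelCell_le_lastStopSet hφ hyD (htop l y) (hdev l y hyD)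
      have hPm : MeasurableSet P := hφ.measurableSet_levelCell l y
      -- The `ν`-mean over `P` is at most `g` at every point of `P`, so it may be integrated over
      -- the remainder of `P`, which carries at least half of its measure.
      calc ν P = μ P * ((μ P)⁻¹ * ν P) := by
            rw [← mul_assoc, ENNReal.mul_inv_cancel (h0 l y) (htop l y), one_mul]
        _ ≤ 2 * μ (P ∩ lastStopSet μ φ f l) * ((μ P)⁻¹ * ν P) := by gcongr
        _ = 2 * ∫⁻ _ in P ∩ lastStopSet μ φ f l, (μ P)⁻¹ * ν P ∂μ := by
            rw [setLIntegral_const]; ring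
        _ ≤ _ := by
            gcongr 2 * ?_
            exact setLIntegral_mono' (hPm.inter hFm) fun z hz => hg l hkl y hyP z hz.1
  refine (ENNReal.tsum_le_tsum hterm).trans ?_
  rw [ENNReal.tsum_mul_left]
  gcongr
  have hinj : Pairwise (Function.onFun Disjoint
      fun j => levelCell φ k x ∩ lastStopSet μ φ f (k + j)) := fun i j hij =>
    (disjoint_lastStopSet (fun h => hij (by lia))).mono inter_subset_right inter_subset_right
  rw [← lintegral_iUnion (fun j => (hφ.measurableSet_levelCell k x).inter
    (measurableSet_lastStopSet hφ _)) hinj]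
  exact lintegral_mono_set (iUnion_subset fun l => inter_subset_left)

/-- The means of `|f|` over the cells around `x` grow at most linearly in the number of selected
cells. -/
lemma avgNorm_levelCell_le (hφ : IsRefining φ) {x : X} {T κ : ℝ≥0∞}
    (h0 : ∀ l, μ (levelCell φ l x) ≠ 0) (htop : ∀ l, μ (levelCell φ l x) ≠ ∞)
    (hκ : ∀ l, μ (levelCell φ l x) ≤ κ * μ (levelCell φ (l + 1) x))
    (hT : ∀ l, meanOsc μ f (levelCell φ l x) ≤ T) (k : ℕ) :
    avgNorm μ f (levelCell φ k x) ≤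
      avgNorm μ f (levelCell φ 0 x) + (2 + κ) * T * tailCount (stopSet μ φ f) 0 x := by
  set A : ℕ → ℝ≥0∞ := fun k => avgNorm μ f (levelCell φ k x) with hA
  set s : ℕ → ℕ := fun k => stopLevel μ φ f k x with hs
  set N : ℕ → ℝ≥0∞ := fun k => ∑ j ∈ Finset.range k, (stopSet μ φ f (j + 1)).indicator 1 x with hN
  -- As long as nothing new is selected, the stopping inequality fails, and the mean of `|f|` stays
  -- within `2 T` of that over the last selected cell.
  have hstep : ∀ k, s (k + 1) = s k → A (k + 1) ≤ A (s k) + 2 * T := by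
    intro k hk
    have hle : s k ≤ k := stopLevel_le k x
    have hno : ¬ (2 * cellDev μ φ f (s k) (s k) x * μ (levelCell φ (k + 1) x) <
        μ (levelCell φ (s k) x) * cellDev μ φ f (s k) (k + 1) x) := by
      intro hlt
      have : s (k + 1) = k + 1 := by
        simp only [hs, stopLevel]
        exact if_pos hlt
      lia
    rw [not_lt] at hno
    have h1 : (μ (levelCell φ (k + 1) x))⁻¹ * cellDev μ φ f (s k) (k + 1) x ≤
        2 * meanOsc μ f (levelCell φ (s k) x) := by
      calc (μ (levelCell φ (k + 1) x))⁻¹ * cellDev μ φ f (s k) (k + 1) x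
          = (μ (levelCell φ (k + 1) x))⁻¹ * (μ (levelCell φ (s k) x))⁻¹ *
            (μ (levelCell φ (s k) x) * cellDev μ φ f (s k) (k + 1) x) := by
            rw [mul_assoc, ← mul_assoc _ (μ (levelCell φ (s k) x)),
              ENNReal.inv_mul_cancel (h0 _) (htop _), one_mul]
        _ ≤ (μ (levelCell φ (k + 1) x))⁻¹ * (μ (levelCell φ (s k) x))⁻¹ *
            (2 * cellDev μ φ f (s k) (s k) x * μ (levelCell φ (k + 1) x)) := by gcongr
        _ = ((μ (levelCell φ (k + 1) x))⁻¹ * μ (levelCell φ (k + 1) x)) *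
            (2 * ((μ (levelCell φ (s k) x))⁻¹ * cellDev μ φ f (s k) (s k) x)) := by ring
        _ = 2 * meanOsc μ f (levelCell φ (s k) x) := by
            rw [ENNReal.inv_mul_cancel (h0 _) (htop _), one_mul]; rfl
    calc A (k + 1) ≤ (μ (levelCell φ (k + 1) x))⁻¹ * cellDev μ φ f (s k) (k + 1) x +
          ‖⨍ z in levelCell φ (s k) x, f z ∂μ‖ₑ := avgNorm_le_add_enorm f _ _
      _ ≤ 2 * T + A (s k) := by
          exact add_le_add (h1.trans (mul_le_mul_right (hT _) 2))
            (enorm_setAverage_le_avgNorm f (h0 _) (htop _))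
      _ = _ := add_comm _ _
  -- A selection costs `2 T` to reach the parent cell and `κ T` for the step from parent to child,
  -- hence `2 + κ`.
  have hmain : ∀ k, A (s k) ≤ A 0 + (2 + κ) * T * N k ∧
      A k ≤ A (s k) + 2 * T := by
    intro k
    induction k with
    | zero => exact ⟨by simp [hs, stopLevel], by simp [hs, stopLevel]⟩
    | succ k ih =>
      have hNs : N (k + 1) = N k + (stopSet μ φ f (k + 1)).indicator 1 x :=
        Finset.sum_range_succ _ _
      rcases stopLevel_succ_eq_or (μ := μ) (φ := φ) (f := f) k x with h | h
      · have hsk : s (k + 1) = k + 1 := h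
        have hone : N (k + 1) = N k + 1 := by
          rw [hNs, indicator_of_mem (show x ∈ stopSet μ φ f (k + 1) from h)]; rfl
        refine ⟨?_, by rw [hsk]; exact le_self_add⟩
        rw [hsk, hone]
        calc A (k + 1) ≤ A k + κ * meanOsc μ f (levelCell φ k x) :=
              avgNorm_le_of_subset f (hφ.levelCell_subset (Nat.le_succ k) x) (h0 _) (htop _) (hκ k)
          _ ≤ A (s k) + 2 * T + κ * T := by
              gcongr
              · exact ih.2
              · exact hT k
          _ ≤ A 0 + (2 + κ) * T * N k + 2 * T + κ * T := by gcongr; exact ih.1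
          _ = _ := by ring
      · have hsk : s (k + 1) = s k := h
        refine ⟨?_, ?_⟩
        · rw [hsk]
          refine ih.1.trans ?_
          gcongr
          rw [hNs]; exact le_self_add
        · rw [hsk]; exact hstep k hsk
  -- Level `0` always counts as selected; this extra unit pays for the final `2 T` after the last
  -- selection.
  have hcount : N k + 1 ≤ tailCount (stopSet μ φ f) 0 x := by
    rw [tailCount_eq_add, add_comm, indicator_of_mem (show x ∈ stopSet μ φ f 0 from rfl)]
    simp only [Pi.one_apply]
    gcongr
    unfold tailCount
    simp only [hN, add_comm _ 1]
    exact ENNReal.sum_le_tsum _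
  calc A k ≤ A 0 + (2 + κ) * T * N k + 2 * T := (hmain k).2.trans (by gcongr; exact (hmain k).1)
    _ ≤ A 0 + (2 + κ) * T * N k + (2 + κ) * T := by gcongr; exact le_self_add
    _ = A 0 + (2 + κ) * T * (N k + 1) := by ring
    _ ≤ _ := by gcongr

end Stopping

/-! ### Dyadic subcubes and the pointwise bound for the maximal function. -/

section Cubes

variable {n : ℕ} {f : (Fin n → ℝ) → ℝ}

lemma isCube_closedBall (a : Fin n → ℝ) {r : ℝ} (hr : 0 < r) : IsCube (Metric.closedBall a r) :=
  ⟨a, r, hr, rfl⟩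

lemma avgNorm_le_maximalFn {Q : Set (Fin n → ℝ)} (hQ : IsCube Q) {x : Fin n → ℝ} (hx : x ∈ Q) :
    avgNorm volume f Q ≤ maximalFn f x :=
  le_iSup_of_le Q (le_iSup_of_le hQ (le_iSup_of_le hx le_rfl))

lemma meanOsc_le_sharpMaximalFn {Q : Set (Fin n → ℝ)} (hQ : IsCube Q) {x : Fin n → ℝ}
    (hx : x ∈ Q) : meanOsc volume f Q ≤ sharpMaximalFn f x :=
  le_iSup_of_le Q (le_iSup_of_le hQ (le_iSup_of_le hx le_rfl))

lemma volume_closedBall_pos (a : Fin n → ℝ) {r : ℝ} (hr : 0 < r) :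
    volume (Metric.closedBall a r) ≠ 0 := (Metric.measure_closedBall_pos volume a hr).ne'

lemma volume_closedBall_ne_top (a : Fin n → ℝ) (r : ℝ) :
    volume (Metric.closedBall a r) ≠ ∞ := measure_closedBall_lt_top.ne

lemma volume_closedBall_mul (a c : Fin n → ℝ) {r t : ℝ} (hr : 0 ≤ r) (ht : 0 ≤ t) :
    volume (Metric.closedBall c (t * r)) = ENNReal.ofReal t ^ n * volume (Metric.closedBall a r) := by
  rw [Real.volume_pi_closedBall _ (by positivity), Real.volume_pi_closedBall _ hr,
    ← ENNReal.ofReal_pow ht, ← ENNReal.ofReal_mul (by positivity), Fintype.card_fin, ← mul_pow]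
  ring_nf

/-- The multi-index of the dyadic subcube of level `k` of the cube `closedBall a r` around `x`. -/
noncomputable def dyadicIndex (a : Fin n → ℝ) (r : ℝ) (k : ℕ) (x : Fin n → ℝ) : Fin n → ℤ :=
  fun i => ⌊2 ^ k * ((x i - (a i - r)) / (2 * r))⌋

/-- Halving `⌊2 u⌋` and rounding down gives `⌊u⌋`; this is what makes dyadic grids nested. -/
lemma Int.floor_eq_of_floor_two_mul_eq {u v : ℝ} (h : ⌊2 * u⌋ = ⌊2 * v⌋) : ⌊u⌋ = ⌊v⌋ := by
  have key : ∀ u v : ℝ, ⌊2 * u⌋ = ⌊2 * v⌋ → ⌊u⌋ ≤ ⌊v⌋ := by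
    intro u v h
    rw [Int.le_floor]
    have h1 : 2 * ⌊u⌋ ≤ ⌊2 * u⌋ := Int.le_floor.2 (by push_cast; linarith [Int.floor_le u])
    have h2 := Int.floor_le (2 * v)
    rw [← h] at h2
    have h3 : ((2 * ⌊u⌋ : ℤ) : ℝ) ≤ ⌊2 * u⌋ := by exact_mod_cast h1
    push_cast at h3
    linarith
  exact le_antisymm (key u v h) (key v u h.symm)

lemma isRefining_dyadicIndex (a : Fin n → ℝ) (r : ℝ) : IsRefining (dyadicIndex a r) where
  measurable k i := by
    have : Measurable (dyadicIndex a r k) := by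
      refine measurable_pi_lambda _ fun j => Int.measurable_floor.comp ?_
      fun_prop
    exact this (measurableSet_singleton i)
  refines k x y h := by
    funext i
    have := congrFun h i
    simp only [dyadicIndex, pow_succ', mul_assoc] at this ⊢
    exact Int.floor_eq_of_floor_two_mul_eq this

lemma levelCell_dyadicIndex_eq (a : Fin n → ℝ) {r : ℝ} (hr : 0 < r) (k : ℕ) (x : Fin n → ℝ) :
    levelCell (dyadicIndex a r) k x = Set.pi univ fun i => Ico
      (a i - r + dyadicIndex a r k x i * (2 * (r / 2 ^ k)))
      (a i - r + (dyadicIndex a r k x i + 1) * (2 * (r / 2 ^ k))) := by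
  have hs : 0 < 2 * (r / 2 ^ k) := by positivity
  ext y
  have hy : ∀ i, 2 ^ k * ((y i - (a i - r)) / (2 * r)) = (y i - (a i - r)) / (2 * (r / 2 ^ k)) := by
    intro i; field_simp
  simp only [levelCell, mem_ofPred_eq, mem_pi, mem_univ, true_implies, mem_Ico]
  rw [funext_iff]
  refine forall_congr' fun i => ?_
  conv_lhs => lhs; rw [dyadicIndex, hy]
  rw [Int.floor_eq_iff, le_div_iff₀ hs, div_lt_iff₀ hs]
  constructor <;> rintro ⟨h1, h2⟩ <;> constructor <;> linarith

/-- The center of a dyadic cell. -/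
noncomputable def dyadicCenter (a : Fin n → ℝ) (r : ℝ) (k : ℕ) (x : Fin n → ℝ) : Fin n → ℝ :=
  fun i => a i - r + (dyadicIndex a r k x i + 1 / 2) * (2 * (r / 2 ^ k))

lemma closedBall_dyadicCenter (a : Fin n → ℝ) {r : ℝ} (hr : 0 < r) (k : ℕ) (x : Fin n → ℝ) :
    Metric.closedBall (dyadicCenter a r k x) (r / 2 ^ k) =
      Icc (fun i => a i - r + dyadicIndex a r k x i * (2 * (r / 2 ^ k)))
        (fun i => a i - r + (dyadicIndex a r k x i + 1) * (2 * (r / 2 ^ k))) := by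
  rw [closedBall_pi _ (by positivity), ← pi_univ_Icc]
  congr 1; funext i
  rw [Real.closedBall_eq_Icc, dyadicCenter]
  congr 1 <;> ring

lemma levelCell_subset_closedBall (a : Fin n → ℝ) {r : ℝ} (hr : 0 < r) (k : ℕ) (x : Fin n → ℝ) :
    levelCell (dyadicIndex a r) k x ⊆ Metric.closedBall (dyadicCenter a r k x) (r / 2 ^ k) := by
  rw [levelCell_dyadicIndex_eq a hr, closedBall_dyadicCenter a hr, ← pi_univ_Icc]
  exact Set.pi_mono fun i _ => Ico_subset_Icc_self

lemma levelCell_ae_eq_closedBall (a : Fin n → ℝ) {r : ℝ} (hr : 0 < r) (k : ℕ) (x : Fin n → ℝ) :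
    levelCell (dyadicIndex a r) k x =ᵐ[volume]
      Metric.closedBall (dyadicCenter a r k x) (r / 2 ^ k) := by
  rw [levelCell_dyadicIndex_eq a hr, closedBall_dyadicCenter a hr]
  exact Measure.univ_pi_Ico_ae_eq_Icc

lemma volume_levelCell (a : Fin n → ℝ) {r : ℝ} (hr : 0 < r) (k : ℕ) (x : Fin n → ℝ) :
    volume (levelCell (dyadicIndex a r) k x) =
      volume (Metric.closedBall (dyadicCenter a r k x) (r / 2 ^ k)) :=
  measure_congr (levelCell_ae_eq_closedBall a hr k x)

lemma volume_levelCell_ne_zero (a : Fin n → ℝ) {r : ℝ} (hr : 0 < r) (k : ℕ) (x : Fin n → ℝ) :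
    volume (levelCell (dyadicIndex a r) k x) ≠ 0 := by
  rw [volume_levelCell a hr]; exact volume_closedBall_pos _ (by positivity)

lemma volume_levelCell_ne_top (a : Fin n → ℝ) {r : ℝ} (hr : 0 < r) (k : ℕ) (x : Fin n → ℝ) :
    volume (levelCell (dyadicIndex a r) k x) ≠ ∞ := by
  rw [volume_levelCell a hr]; exact volume_closedBall_ne_top _ _

lemma dyadicIndex_zero_center (a : Fin n → ℝ) {r : ℝ} (hr : 0 < r) : dyadicIndex a r 0 a = 0 := by
  funext i
  simp only [dyadicIndex, Pi.zero_apply, Int.floor_eq_zero_iff]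
  have : 2 ^ 0 * ((a i - (a i - r)) / (2 * r)) = 1 / 2 := by field_simp; ring
  rw [this]; norm_num

lemma dyadicCenter_zero (a : Fin n → ℝ) {r : ℝ} (hr : 0 < r) : dyadicCenter a r 0 a = a := by
  funext i
  simp [dyadicCenter, dyadicIndex_zero_center a hr]

lemma topCell_subset (a : Fin n → ℝ) {r : ℝ} (hr : 0 < r) :
    levelCell (dyadicIndex a r) 0 a ⊆ Metric.closedBall a r := by
  simpa [dyadicCenter_zero a hr] using levelCell_subset_closedBall a hr 0 a

lemma topCell_ae_eq (a : Fin n → ℝ) {r : ℝ} (hr : 0 < r) :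
    levelCell (dyadicIndex a r) 0 a =ᵐ[volume] Metric.closedBall a r := by
  simpa [dyadicCenter_zero a hr] using levelCell_ae_eq_closedBall a hr 0 a

lemma meanOsc_levelCell_le (a : Fin n → ℝ) {r : ℝ} (hr : 0 < r) (k : ℕ) (x : Fin n → ℝ) :
    meanOsc volume f (levelCell (dyadicIndex a r) k x) ≤ sharpMaximalFn f x := by
  rw [meanOsc_congr_set (levelCell_ae_eq_closedBall a hr k x)]
  exact meanOsc_le_sharpMaximalFn (isCube_closedBall _ (by positivity))
    (levelCell_subset_closedBall a hr k x (mem_levelCell_self k x))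

lemma volume_levelCell_eq_mul (a : Fin n → ℝ) {r : ℝ} (hr : 0 < r) (k : ℕ) (x c : Fin n → ℝ)
    {t : ℝ} (ht : 0 ≤ t) :
    volume (Metric.closedBall c (t * (r / 2 ^ k))) =
      ENNReal.ofReal t ^ n * volume (levelCell (dyadicIndex a r) k x) := by
  rw [volume_levelCell a hr, volume_closedBall_mul (dyadicCenter a r k x) c (by positivity) ht]

lemma volume_levelCell_succ (a : Fin n → ℝ) {r : ℝ} (hr : 0 < r) (k : ℕ) (x : Fin n → ℝ) :
    volume (levelCell (dyadicIndex a r) k x) ≤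
      2 ^ n * volume (levelCell (dyadicIndex a r) (k + 1) x) := by
  have := volume_levelCell_eq_mul a hr (k + 1) x (dyadicCenter a r k x) (t := 2) (by norm_num)
  rw [volume_levelCell a hr k, show r / 2 ^ k = 2 * (r / 2 ^ (k + 1)) by rw [pow_succ]; field_simp,
    this]
  simp

/-- The maximal function is at most its essential infimum over a cube plus the sharp maximal
function times the number of cubes selected by the stopping procedure. -/
lemma maximalFn_le_add_sharpMaximalFn (hf : LocallyIntegrable f volume) (a : Fin n → ℝ) {r : ℝ}
    (hr : 0 < r) {x : Fin n → ℝ} (hx : x ∈ levelCell (dyadicIndex a r) 0 a) {E : ℝ≥0∞}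
    (hE : ∀ R, IsCube R → Metric.closedBall a r ⊆ R → avgNorm volume f R ≤ E) :
    maximalFn f x ≤ (6 ^ n + 3 ^ n + 2 ^ n + 3) *
      tailCount (stopSet volume (dyadicIndex a r) f) 0 x * sharpMaximalFn f x + E := by
  set φ := dyadicIndex a r with hφdef
  have hφ : IsRefining φ := isRefining_dyadicIndex a r
  set T := sharpMaximalFn f x with hT
  set N := tailCount (stopSet volume φ f) 0 x with hN
  -- The top cell is selected; `N ≥ 1` later absorbs the error terms without a factor `N`.
  have hN1 : 1 ≤ N := by
    rw [hN, tailCount_eq_add, indicator_of_mem (show x ∈ stopSet volume φ f 0 from rfl)]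
    exact le_self_add
  have hxQ : x ∈ Metric.closedBall a r := topCell_subset a hr hx
  refine iSup_le fun R => iSup_le fun hR => iSup_le fun hxR => ?_
  obtain ⟨c, ρ, hρ, rfl⟩ := hR
  change avgNorm volume f _ ≤ _
  set R3 := Metric.closedBall c (3 * ρ) with hR3
  have hR3cube : IsCube R3 := isCube_closedBall c (by positivity)
  have hsub : Metric.closedBall c ρ ⊆ R3 := Metric.closedBall_subset_closedBall (by linarith)
  have hvol3 : volume R3 ≤ 3 ^ n * volume (Metric.closedBall c ρ) := by
    rw [hR3, volume_closedBall_mul c c hρ.le (by norm_num)]; simp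
  have hosc : meanOsc volume f R3 ≤ T := meanOsc_le_sharpMaximalFn hR3cube (hsub hxR)
  have hfirst : avgNorm volume f (Metric.closedBall c ρ) ≤ avgNorm volume f R3 + 3 ^ n * T :=
    (avgNorm_le_of_subset f hsub (volume_closedBall_pos c hρ) (volume_closedBall_ne_top _ _)
      hvol3).trans (add_le_add_right (mul_le_mul_right hosc _) _)
  rw [Metric.mem_closedBall] at hxQ hxR
  -- A cube at least as large as `Q` that meets it has a triple containing `Q`, so its mean is
  -- governed by `E`.
  rcases le_or_gt r ρ with h | h
  · have hQR : Metric.closedBall a r ⊆ R3 := by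
      intro y hy
      rw [Metric.mem_closedBall] at hy ⊢
      have h1 := dist_triangle y a c
      have h2 := dist_triangle a x c
      rw [dist_comm a x] at h2
      linarith
    calc avgNorm volume f (Metric.closedBall c ρ) ≤ avgNorm volume f R3 + 3 ^ n * T := hfirst
      _ ≤ E + 3 ^ n * T := by gcongr; exact hE R3 hR3cube hQR
      _ = 3 ^ n * 1 * T + E := by ring
      _ ≤ _ := by
        gcongr
        calc (3 : ℝ≥0∞) ^ n ≤ 3 ^ n + (6 ^ n + 2 ^ n + 3) := le_self_add
          _ = _ := by ring
  -- For a smaller cube, pick the level with `r / 2 ^ k ≤ ρ ≤ 2 (r / 2 ^ k)`: the dyadic cell around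
  -- `x` then lies in the tripled cube and is smaller in side by at most a factor `6`.
  · obtain ⟨m, hm1, hm2⟩ := exists_nat_pow_near (show 1 ≤ r / ρ by rw [le_div_iff₀ hρ]; linarith)
      (show (1 : ℝ) < 2 by norm_num)
    rw [le_div_iff₀ hρ] at hm1
    rw [div_lt_iff₀ hρ] at hm2
    set k := m + 1 with hk
    have hk1 : r / 2 ^ k ≤ ρ := by rw [div_le_iff₀ (by positivity)]; linarith
    have hk2 : 3 * ρ ≤ 6 * (r / 2 ^ k) := by
      have : ρ ≤ 2 * (r / 2 ^ k) := by
        rw [hk, pow_succ, show 2 * (r / (2 ^ m * 2)) = r / 2 ^ m by field_simp,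
          le_div_iff₀ (by positivity)]
        linarith
      linarith
    set P := levelCell φ k x with hP
    have hPR : P ⊆ R3 := by
      intro y hy
      have h1 := levelCell_subset_closedBall a hr k x hy
      have h2 := levelCell_subset_closedBall a hr k x (mem_levelCell_self k x)
      rw [Metric.mem_closedBall] at h1 h2 ⊢
      have h3 := dist_triangle_right y x (dyadicCenter a r k x)
      have h4 := dist_triangle y x c
      linarith
    have hvolP : volume R3 ≤ 6 ^ n * volume P := by
      calc volume R3 ≤ volume (Metric.closedBall c (6 * (r / 2 ^ k))) :=
            measure_mono (Metric.closedBall_subset_closedBall hk2)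
        _ = _ := by rw [volume_levelCell_eq_mul a hr k x c (by norm_num)]; simp [hP, hφdef]
    have hsecond : avgNorm volume f R3 ≤ avgNorm volume f P + (6 ^ n + 1) * T :=
      (avgNorm_le_of_superset hf.aestronglyMeasurable hPR (volume_levelCell_ne_zero a hr k x)
        (volume_closedBall_ne_top _ _) hvolP).trans
        (add_le_add_right (mul_le_mul_right hosc _) _)
    have hthird : avgNorm volume f P ≤ avgNorm volume f (levelCell φ 0 x) + (2 + 2 ^ n) * T * N :=
      avgNorm_levelCell_le hφ (fun l => volume_levelCell_ne_zero a hr l x)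
        (fun l => volume_levelCell_ne_top a hr l x) (fun l => volume_levelCell_succ a hr l x)
        (fun l => meanOsc_levelCell_le a hr l x) k
    have htop : avgNorm volume f (levelCell φ 0 x) ≤ E := by
      rw [levelCell_eq_of_mem hx, avgNorm_congr_set (topCell_ae_eq a hr)]
      exact hE _ (isCube_closedBall a hr) Subset.rfl
    calc avgNorm volume f (Metric.closedBall c ρ) ≤ avgNorm volume f R3 + 3 ^ n * T := hfirst
      _ ≤ avgNorm volume f P + (6 ^ n + 1) * T + 3 ^ n * T := by gcongr
      _ ≤ E + (2 + 2 ^ n) * T * N + (6 ^ n + 1) * T + 3 ^ n * T := by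
          gcongr; exact hthird.trans (by gcongr)
      _ = (6 ^ n + 3 ^ n + 1) * 1 * T + (2 ^ n + 2) * N * T + E := by ring
      _ ≤ (6 ^ n + 3 ^ n + 1) * N * T + (2 ^ n + 2) * N * T + E := by gcongr
      _ = _ := by ring

end Cubes

/-! ### Packing with respect to the weight, and the direct estimate. -/

section Weights

variable {n : ℕ} {w f : (Fin n → ℝ) → ℝ}

/-- The measure with density `w`. -/
noncomputable def weightMeasure (w : (Fin n → ℝ) → ℝ) : Measure (Fin n → ℝ) :=
  volume.withDensity fun x => ENNReal.ofReal (w x)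

lemma weightMeasure_apply {S : Set (Fin n → ℝ)} (hS : MeasurableSet S) :
    weightMeasure w S = weightMass w S := withDensity_apply _ hS

lemma weightMass_congr_set {S R : Set (Fin n → ℝ)} (h : S =ᵐ[volume] R) :
    weightMass w S = weightMass w R := by
  simp only [weightMass, Measure.restrict_congr_set h]

lemma weightMass_le_avgNorm (w : (Fin n → ℝ) → ℝ) (S : Set (Fin n → ℝ)) :
    (volume S)⁻¹ * weightMass w S ≤ avgNorm volume w S := by
  unfold weightMass avgNorm
  gcongr with x
  exact Real.ofReal_le_enorm _

lemma IsWeight.mass_ne_top (hw : IsWeight w) (a : Fin n → ℝ) (r : ℝ) :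
    weightMass w (Metric.closedBall a r) ≠ ∞ := by
  have := hw.locallyIntegrable.integrableOn_isCompact (isCompact_closedBall a r)
  refine ne_top_of_le_ne_top this.2.ne ?_
  exact lintegral_mono fun x => Real.ofReal_le_enorm _

lemma IsWeight.aemeasurable (hw : IsWeight w) :
    AEMeasurable (fun x => ENNReal.ofReal (w x)) volume :=
  hw.locallyIntegrable.aestronglyMeasurable.aemeasurable.ennreal_ofReal

lemma lintegral_maximalFn_indicator_le (hw : IsWeight w) (a : Fin n → ℝ) {r : ℝ} (hr : 0 < r) :
    ∫⁻ x in Metric.closedBall a r, maximalFn ((Metric.closedBall a r).indicator w) x ≤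
      ainftyConst w * weightMass w (Metric.closedBall a r) := by
  have hQ := isCube_closedBall a hr
  have h : (weightMass w (Metric.closedBall a r))⁻¹ *
      ∫⁻ x in Metric.closedBall a r, maximalFn ((Metric.closedBall a r).indicator w) x ≤
      ainftyConst w := le_iSup_of_le _ (le_iSup_of_le hQ le_rfl)
  have h0 := (hw.mass_pos _ hQ).ne'
  have ht := hw.mass_ne_top a r
  calc _ = (weightMass w (Metric.closedBall a r))⁻¹ *
      (∫⁻ x in Metric.closedBall a r, maximalFn ((Metric.closedBall a r).indicator w) x) *
        weightMass w (Metric.closedBall a r) := by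
        rw [mul_comm _⁻¹, mul_assoc, ENNReal.inv_mul_cancel h0 ht, mul_one]
    _ ≤ _ := by gcongr

lemma cellDev_ne_top (hf : LocallyIntegrable f volume) (a : Fin n → ℝ) {r : ℝ} (hr : 0 < r)
    (k : ℕ) (x : Fin n → ℝ) : cellDev volume (dyadicIndex a r) f k k x ≠ ∞ := by
  unfold cellDev
  rw [Measure.restrict_congr_set (levelCell_ae_eq_closedBall a hr k x)]
  have h1 := hf.integrableOn_isCompact
    (isCompact_closedBall (dyadicCenter a r k x) (r / 2 ^ k))
  have h2 : IntegrableOn (fun _ => ⨍ z in Metric.closedBall (dyadicCenter a r k x) (r / 2 ^ k), f z)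
    (Metric.closedBall (dyadicCenter a r k x) (r / 2 ^ k)) volume :=
    integrableOn_const (volume_closedBall_ne_top _ _)
  exact (Integrable.sub h1 h2).2.ne

/-- The Fujii–Wilson constant enters here: the `w`-means over subcells of a cell are dominated by
`M(w χ_Q)`, with `Q` the closed cube of that cell, and its integral over `Q` is at most `[w] w(Q)`.
-/
lemma tsum_weightMeasure_stopSet_le (hw : IsWeight w) (hf : LocallyIntegrable f volume)
    (a : Fin n → ℝ) {r : ℝ} (hr : 0 < r) (k : ℕ) (x : Fin n → ℝ) :
    ∑' j, weightMeasure w (stopSet volume (dyadicIndex a r) f (k + j) ∩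
      levelCell (dyadicIndex a r) k x) ≤
      2 * ainftyConst w * weightMeasure w (levelCell (dyadicIndex a r) k x) := by
  set φ := dyadicIndex a r with hφdef
  have hφ : IsRefining φ := isRefining_dyadicIndex a r
  set Q := Metric.closedBall (dyadicCenter a r k x) (r / 2 ^ k) with hQ
  have hae : levelCell φ k x =ᵐ[volume] Q := levelCell_ae_eq_closedBall a hr k x
  have := tsum_measure_stopSet_le (μ := volume) (f := f) hφ (ν := weightMeasure w) (k := k) (x := x)
    (volume_levelCell_ne_zero a hr) (volume_levelCell_ne_top a hr)
    (fun l y _ => cellDev_ne_top hf a hr l y) (g := maximalFn (Q.indicator w)) ?_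
  · refine this.trans ?_
    rw [Measure.restrict_congr_set hae, weightMeasure_apply (hφ.measurableSet_levelCell k x),
      weightMass_congr_set hae, mul_assoc]
    gcongr
    exact lintegral_maximalFn_indicator_le hw _ (by positivity)
  · intro l hkl y hy z hz
    have hcellm := hφ.measurableSet_levelCell l y
    have hsub : levelCell φ l y ⊆ Q := by
      have h1 := hφ.levelCell_subset hkl y
      rw [levelCell_eq_of_mem hy] at h1
      exact h1.trans (levelCell_subset_closedBall a hr k x)
    have haey := levelCell_ae_eq_closedBall a hr l y
    calc (volume (levelCell φ l y))⁻¹ * weightMeasure w (levelCell φ l y)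
        = (volume (levelCell φ l y))⁻¹ * weightMass (Q.indicator w) (levelCell φ l y) := by
          rw [weightMeasure_apply hcellm]
          congr 1
          exact setLIntegral_congr_fun hcellm fun u hu => by
            simp only [indicator_of_mem (hsub hu)]
      _ ≤ avgNorm volume (Q.indicator w) (levelCell φ l y) := weightMass_le_avgNorm _ _
      _ = avgNorm volume (Q.indicator w)
          (Metric.closedBall (dyadicCenter a r l y) (r / 2 ^ l)) := avgNorm_congr_set haey
      _ ≤ _ := avgNorm_le_maximalFn (isCube_closedBall _ (by positivity))
          (levelCell_subset_closedBall a hr l y hz)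

/-- Monotonicity in the exponent of normalized `L^p` norms. -/
lemma lintegral_rpow_mean_mono {X : Type*} [MeasurableSpace X] {μ : Measure X}
    (h0 : μ univ ≠ 0) (htop : μ univ ≠ ∞) {F : X → ℝ≥0∞} (hF : Measurable F) {p q : ℝ}
    (hp : 0 < p) (hpq : p ≤ q) :
    ((μ univ)⁻¹ * ∫⁻ x, F x ^ p ∂μ) ^ (1 / p) ≤ ((μ univ)⁻¹ * ∫⁻ x, F x ^ q ∂μ) ^ (1 / q) := by
  have : IsProbabilityMeasure ((μ univ)⁻¹ • μ) :=
    ⟨by rw [Measure.smul_apply, smul_eq_mul, ENNReal.inv_mul_cancel h0 htop]⟩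
  have := eLpNorm'_le_eLpNorm'_of_exponent_le hp hpq ((μ univ)⁻¹ • μ) hF.aestronglyMeasurable
  simpa only [eLpNorm', enorm_eq_self, lintegral_smul_measure, smul_eq_mul] using this

theorem weightedLpRatio_le (hw : IsWeight w) (hf : LocallyIntegrable f volume) (a : Fin n → ℝ)
    {r : ℝ} (hr : 0 < r) {p : ℝ} (hp : 1 ≤ p) :
    weightedLpRatio w f p (Metric.closedBall a r) ≤
      (6 ^ n + 3 ^ n + 2 ^ n + 3) * (4 * ainftyConst w * ENNReal.ofReal p) := by
  set φ := dyadicIndex a r with hφdef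
  have hφ : IsRefining φ := isRefining_dyadicIndex a r
  set Q := Metric.closedBall a r with hQ
  set P := levelCell φ 0 a with hP
  set N := tailCount (stopSet volume φ f) 0 with hN
  set K : ℝ≥0∞ := 6 ^ n + 3 ^ n + 2 ^ n + 3 with hK
  set W := weightMass w Q with hW
  set A := ainftyConst w with hA
  have hPm : MeasurableSet P := hφ.measurableSet_levelCell 0 a
  have hae : P =ᵐ[volume] Q := topCell_ae_eq a hr
  have hp0 : 0 < p := by linarith
  have hQcube : IsCube Q := isCube_closedBall a hr
  have hNm : Measurable N :=
    measurable_tailCount (fun k => (isSaturated_stopSet hφ k).measurableSet hφ) 0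
  have hWP : weightMeasure w P = W := by rw [weightMeasure_apply hPm, weightMass_congr_set hae]
  have hWuniv : (weightMeasure w).restrict P univ = W := by rw [Measure.restrict_apply_univ, hWP]
  have hW0 : W ≠ 0 := (hw.mass_pos Q hQcube).ne'
  have hWt : W ≠ ∞ := hw.mass_ne_top a r
  -- A cube containing `Q` competes in the supremum defining `Mf` at every point of `Q`.
  have hE : ∀ R, IsCube R → Q ⊆ R → avgNorm volume f R ≤ essInfMaximal f Q := by
    intro R hR hQR
    refine le_essInf_of_ae_le _ ?_
    filter_upwards [ae_restrict_mem Metric.isClosed_closedBall.measurableSet] with y hy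
    exact avgNorm_le_maximalFn hR (hQR hy)
  have hpt : ∀ x ∈ P, (maximalFn f x - essInfMaximal f Q) / sharpMaximalFn f x ≤ K * N x := by
    intro x hx
    refine ENNReal.div_le_of_le_mul (tsub_le_iff_right.2 ?_)
    exact maximalFn_le_add_sharpMaximalFn hf a hr hx hE
  have hint : ∫⁻ x in Q, ((maximalFn f x - essInfMaximal f Q) / sharpMaximalFn f x) ^ p *
      ENNReal.ofReal (w x) ≤ K ^ p * ∫⁻ x in P, N x ^ p ∂(weightMeasure w) := by
    rw [← Measure.restrict_congr_set hae]
    calc _ ≤ ∫⁻ x in P, (K * N x) ^ p * ENNReal.ofReal (w x) := by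
          refine setLIntegral_mono' hPm fun x hx => ?_
          gcongr
          exact hpt x hx
      _ = ∫⁻ x in P, (K * N x) ^ p ∂(weightMeasure w) := by
          rw [weightMeasure, restrict_withDensity hPm,
            lintegral_withDensity_eq_lintegral_mul₀ hw.aemeasurable.restrict
              ((hNm.const_mul K).pow_const p).aemeasurable]
          simp only [Pi.mul_apply, mul_comm]
      _ = _ := by
          simp_rw [ENNReal.mul_rpow_of_nonneg _ _ hp0.le]
          rw [lintegral_const_mul _ (hNm.pow_const p)]
  -- Moments are available for integer exponents only. Rounding up is allowed by monotonicity of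
  -- normalized norms, and `m ≤ 2 p` since `p ≥ 1`.
  set m := ⌈p⌉₊ with hm
  have hpm : p ≤ m := Nat.le_ceil p
  have hm0 : m ≠ 0 := by
    intro h; rw [h] at hpm; norm_num at hpm; linarith
  have hmoment : ∫⁻ x in P, N x ^ (m : ℝ) ∂(weightMeasure w) ≤ (m * (2 * A)) ^ m * W := by
    simp_rw [ENNReal.rpow_natCast]
    refine (lintegral_tailCount_pow_le hφ (isSaturated_stopSet hφ)
      (tsum_weightMeasure_stopSet_le hw hf a hr) m 0 a).trans ?_
    rw [hWP, mul_pow (m : ℝ≥0∞) (2 * A) m]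
    gcongr
    exact_mod_cast Nat.factorial_le_pow m
  have hm2 : (m : ℝ≥0∞) ≤ 2 * ENNReal.ofReal p := by
    have : (m : ℝ) ≤ 2 * p := by have := Nat.ceil_lt_add_one hp0.le; rw [← hm] at this; linarith
    calc (m : ℝ≥0∞) = ENNReal.ofReal m := by simp
      _ ≤ ENNReal.ofReal (2 * p) := ENNReal.ofReal_le_ofReal this
      _ = _ := by rw [ENNReal.ofReal_mul (by norm_num)]; simp
  unfold weightedLpRatio
  calc (W⁻¹ * ∫⁻ x in Q, ((maximalFn f x - essInfMaximal f Q) / sharpMaximalFn f x) ^ p *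
      ENNReal.ofReal (w x)) ^ (1 / p)
      ≤ (W⁻¹ * (K ^ p * ∫⁻ x in P, N x ^ p ∂(weightMeasure w))) ^ (1 / p) := by gcongr
    _ = K * (W⁻¹ * ∫⁻ x in P, N x ^ p ∂(weightMeasure w)) ^ (1 / p) := by
        rw [mul_left_comm, ENNReal.mul_rpow_of_nonneg _ _ (by positivity), ← ENNReal.rpow_mul,
          mul_one_div_cancel hp0.ne', ENNReal.rpow_one]
    _ ≤ K * (W⁻¹ * ∫⁻ x in P, N x ^ (m : ℝ) ∂(weightMeasure w)) ^ (1 / (m : ℝ)) := by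
        gcongr K * ?_
        have := lintegral_rpow_mean_mono (μ := (weightMeasure w).restrict P) (by rwa [hWuniv])
          (by rwa [hWuniv]) hNm hp0 hpm
        rwa [hWuniv] at this
    _ ≤ K * (W⁻¹ * ((m * (2 * A)) ^ m * W)) ^ (1 / (m : ℝ)) := by gcongr
    _ = K * (m * (2 * A)) := by
        rw [mul_left_comm, ENNReal.inv_mul_cancel hW0 hWt, mul_one, ← ENNReal.rpow_natCast,
          ← ENNReal.rpow_mul, mul_one_div_cancel (by exact_mod_cast hm0), ENNReal.rpow_one]
    _ ≤ K * ((2 * ENNReal.ofReal p) * (2 * A)) := by gcongr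
    _ = _ := by ring

end Weights

/-! ### The weak type inequality and localization of the maximal function. -/

section WeakType

variable {n : ℕ} {f : (Fin n → ℝ) → ℝ}

lemma lt_maximalFn_iff {t : ℝ≥0∞} {x : Fin n → ℝ} :
    t < maximalFn f x ↔ ∃ c ρ, 0 < ρ ∧ x ∈ Metric.closedBall c ρ ∧
      t < avgNorm volume f (Metric.closedBall c ρ) := by
  simp only [maximalFn, lt_iSup_iff]
  constructor
  · rintro ⟨_, ⟨c, ρ, hρ, rfl⟩, hx, ht⟩
    exact ⟨c, ρ, hρ, hx, ht⟩
  · rintro ⟨c, ρ, hρ, hx, ht⟩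
    exact ⟨_, ⟨c, ρ, hρ, rfl⟩, hx, ht⟩

/-- A closed cube whose mean exceeds `t` can be enlarged slightly without losing this, and the
interior of the larger cube is a neighborhood of `x`. -/
lemma isOpen_lt_maximalFn (f : (Fin n → ℝ) → ℝ) (t : ℝ≥0∞) :
    IsOpen {x | t < maximalFn f x} := by
  rw [isOpen_iff_mem_nhds]
  intro x hx
  obtain ⟨c, ρ, hρ, hxc, ht⟩ := lt_maximalFn_iff.1 hx
  set I := ∫⁻ y in Metric.closedBall c ρ, ‖f y‖ₑ with hI
  have hvol : ∀ s : ℝ, 0 ≤ s → volume (Metric.closedBall c s) = ENNReal.ofReal ((2 * s) ^ n) := by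
    intro s hs
    rw [Real.volume_pi_closedBall _ hs, Fintype.card_fin]
  have hcont : Filter.Tendsto (fun s : ℝ => (ENNReal.ofReal ((2 * s) ^ n))⁻¹ * I)
      (nhdsWithin ρ (Ioi ρ)) (nhds ((ENNReal.ofReal ((2 * ρ) ^ n))⁻¹ * I)) := by
    refine ENNReal.Tendsto.mul_const ?_ (Or.inl (by simp))
    refine tendsto_inv_iff.2 ?_
    refine Filter.Tendsto.mono_left ?_ nhdsWithin_le_nhds
    refine ENNReal.tendsto_ofReal ?_
    exact (Continuous.tendsto (by fun_prop) ρ)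
  have ht' : t < (ENNReal.ofReal ((2 * ρ) ^ n))⁻¹ * I := by
    rw [← hvol ρ hρ.le]; exact ht
  obtain ⟨s, hs, hρs⟩ := ((hcont.eventually_const_lt ht').and self_mem_nhdsWithin).exists
  have hρs : ρ < s := hρs
  have hlarge : t < avgNorm volume f (Metric.closedBall c s) := by
    refine hs.trans_le ?_
    rw [← hvol s (hρ.le.trans hρs.le), avgNorm, hI]
    gcongr
  have hmem : Metric.ball c s ∈ nhds x :=
    Metric.isOpen_ball.mem_nhds (Metric.closedBall_subset_ball hρs hxc)
  filter_upwards [hmem] with y hy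
  exact lt_maximalFn_iff.2 ⟨c, s, hρ.trans hρs, Metric.ball_subset_closedBall hy, hlarge⟩

/-- The weak type `(1, 1)` inequality for the maximal function. -/
lemma mul_volume_lt_maximalFn_le (hn : 1 ≤ n) (f : (Fin n → ℝ) → ℝ) (t : ℝ≥0∞) :
    t * volume {x | t < maximalFn f x} ≤ 4 ^ n * ∫⁻ x, ‖f x‖ₑ := by
  set I := ∫⁻ x, ‖f x‖ₑ with hI
  rcases eq_or_ne t 0 with rfl | ht0
  · simp
  rcases eq_or_ne t ∞ with rfl | htt
  · simp
  rcases eq_or_ne I ∞ with hItop | hItop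
  · simp [hItop]
  set T : Set ((Fin n → ℝ) × ℝ) :=
    {b | 0 < b.2 ∧ t < avgNorm volume f (Metric.closedBall b.1 b.2)} with hT
  have havg : ∀ b ∈ T, t * volume (Metric.closedBall b.1 b.2) ≤
      ∫⁻ x in Metric.closedBall b.1 b.2, ‖f x‖ₑ := by
    intro b hb
    calc t * volume (Metric.closedBall b.1 b.2)
        ≤ avgNorm volume f (Metric.closedBall b.1 b.2) * volume (Metric.closedBall b.1 b.2) := by
          gcongr; exact hb.2.le
      _ = _ := by
          rw [avgNorm, mul_comm, ← mul_assoc, ENNReal.mul_inv_cancel (volume_closedBall_pos _ hb.1)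
            (volume_closedBall_ne_top _ _), one_mul]
  -- Vitali's lemma needs bounded radii. They are, since the volumes are at most `I / t` and `2 ρ ≤
  -- (2 ρ) ^ n` when `ρ > 1`.
  have hrad : ∀ b ∈ T, b.2 ≤ max 1 (I / t).toReal := by
    intro b hb
    rcases le_or_gt b.2 1 with h | h
    · exact h.trans (le_max_left _ _)
    · refine le_trans ?_ (le_max_right _ _)
      have h1 : volume (Metric.closedBall b.1 b.2) ≤ I / t := by
        rw [ENNReal.le_div_iff_mul_le (Or.inl ht0) (Or.inl htt), mul_comm]
        exact (havg b hb).trans (setLIntegral_le_lintegral _ _)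
      rw [Real.volume_pi_closedBall _ hb.1.le, Fintype.card_fin] at h1
      have h2 := (ENNReal.ofReal_le_iff_le_toReal (ENNReal.div_lt_top hItop ht0).ne).1 h1
      have h3 : 2 * b.2 ≤ (2 * b.2) ^ n := le_self_pow₀ (by linarith) (by lia)
      linarith
  -- The enlargement factor `4` is the source of the constant `4 ^ n`.
  obtain ⟨u, huT, hud, hcov⟩ := Vitali.exists_disjoint_subfamily_covering_enlargement_closedBall
    T (fun b => b.1) (fun b => b.2) _ hrad 4 (by norm_num)
  have huc : u.Countable := hud.countable_of_nonempty_interior fun b hb =>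
    ⟨b.1, by
      rw [mem_interior_iff_mem_nhds]
      exact Metric.closedBall_mem_nhds _ (huT hb).1⟩
  have : Countable u := huc.to_subtype
  have hsub : {x | t < maximalFn f x} ⊆ ⋃ b : u, Metric.closedBall b.1.1 (4 * b.1.2) := by
    intro x hx
    obtain ⟨c, ρ, hρ, hxc, ht⟩ := lt_maximalFn_iff.1 hx
    obtain ⟨b, hb, hsub⟩ := hcov (c, ρ) ⟨hρ, ht⟩
    exact mem_iUnion.2 ⟨⟨b, hb⟩, hsub hxc⟩
  calc t * volume {x | t < maximalFn f x}
      ≤ t * ∑' b : u, volume (Metric.closedBall b.1.1 (4 * b.1.2)) := by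
        gcongr
        exact (measure_mono hsub).trans (measure_iUnion_le _)
    _ = ∑' b : u, 4 ^ n * (t * volume (Metric.closedBall b.1.1 b.1.2)) := by
        rw [← ENNReal.tsum_mul_left]
        refine tsum_congr fun b => ?_
        rw [volume_closedBall_mul b.1.1 b.1.1 (huT b.2).1.le (by norm_num)]
        simp only [ENNReal.ofReal_ofNat]
        ring
    _ ≤ ∑' b : u, 4 ^ n * ∫⁻ x in Metric.closedBall b.1.1 b.1.2, ‖f x‖ₑ := by
        refine ENNReal.tsum_le_tsum fun b => ?_
        gcongr
        exact havg b.1 (huT b.2)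
    _ = 4 ^ n * ∫⁻ x in ⋃ b : u, Metric.closedBall b.1.1 b.1.2, ‖f x‖ₑ := by
        rw [ENNReal.tsum_mul_left, lintegral_iUnion
          (fun b : u => Metric.isClosed_closedBall.measurableSet)]
        intro b b' hbb
        exact hud b.2 b'.2 (fun h => hbb (Subtype.ext h))
    _ ≤ _ := by gcongr; exact setLIntegral_le_lintegral _ _

lemma ae_maximalFn_ne_top (hn : 1 ≤ n) (hf : ∫⁻ x, ‖f x‖ₑ ≠ ∞) : ∀ᵐ x, maximalFn f x ≠ ∞ := by
  rw [ae_iff]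
  simp only [ne_eq, not_not]
  set v := volume {x | maximalFn f x = ∞} with hv
  have hbound : ∀ k : ℕ, (k : ℝ≥0∞) * v ≤ 4 ^ n * ∫⁻ x, ‖f x‖ₑ := by
    intro k
    refine le_trans ?_ (mul_volume_lt_maximalFn_le hn f k)
    refine mul_le_mul_right (measure_mono fun x hx => ?_) _
    simp only [mem_ofPred_eq] at hx ⊢
    rw [hx]; exact ENNReal.natCast_lt_top k
  by_contra hv0
  have hfin : 4 ^ n * ∫⁻ x, ‖f x‖ₑ ≠ ∞ := ENNReal.mul_ne_top (by simp) hf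
  obtain ⟨k, hk⟩ := ENNReal.exists_nat_mul_gt hv0 hfin
  exact absurd (hbound k) (not_le.2 hk)

/-- Lebesgue's differentiation theorem bounds a function by its maximal function. -/
lemma ae_enorm_le_maximalFn (hf : LocallyIntegrable f volume) :
    ∀ᵐ x, ‖f x‖ₑ ≤ maximalFn f x := by
  have hnorm : LocallyIntegrable (fun y => ‖f y‖) volume := fun x =>
    let ⟨s, hs, h⟩ := hf x
    ⟨s, hs, h.norm⟩
  filter_upwards [IsUnifLocDoublingMeasure.ae_tendsto_average volume hnorm 1] with x hx
  have hδ : Filter.Tendsto (fun j : ℕ => 1 / ((j : ℝ) + 1)) Filter.atTop (nhdsWithin 0 (Ioi 0)) :=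
    tendsto_nhdsWithin_iff.2 ⟨tendsto_one_div_add_atTop_nhds_zero_nat,
      Filter.Eventually.of_forall fun j => by simp only [mem_Ioi]; positivity⟩
  have hlim := hx (fun _ => x) _ hδ
    (Filter.Eventually.of_forall fun j => Metric.mem_closedBall_self (by positivity))
  have hlim2 := (continuous_enorm.tendsto _).comp hlim
  rw [enorm_norm] at hlim2
  refine le_of_tendsto' hlim2 fun j => ?_
  have hpos : (0 : ℝ) < 1 / ((j : ℝ) + 1) := by positivity
  refine (enorm_setAverage_le_avgNorm (fun y => ‖f y‖) (volume_closedBall_pos x hpos)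
    (volume_closedBall_ne_top _ _)).trans ?_
  have : avgNorm volume (fun y => ‖f y‖) (Metric.closedBall x (1 / ((j : ℝ) + 1))) =
      avgNorm volume f (Metric.closedBall x (1 / ((j : ℝ) + 1))) := by simp [avgNorm]
  rw [this]
  exact avgNorm_le_maximalFn (isCube_closedBall x hpos) (Metric.mem_closedBall_self hpos.le)

lemma maximalFn_le_indicator_add (f : (Fin n → ℝ) → ℝ) (t : ℝ≥0∞) (x : Fin n → ℝ) :
    maximalFn f x ≤ maximalFn ({y | t < ‖f y‖ₑ}.indicator f) x + t := by
  refine iSup_le fun R => iSup_le fun hR => iSup_le fun hxR => ?_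
  calc (volume R)⁻¹ * ∫⁻ y in R, ‖f y‖ₑ
      ≤ (volume R)⁻¹ * ∫⁻ y in R, (‖{y | t < ‖f y‖ₑ}.indicator f y‖ₑ + t) := by
        gcongr with y
        by_cases h : t < ‖f y‖ₑ
        · rw [indicator_of_mem (show y ∈ {y | t < ‖f y‖ₑ} from h)]; exact le_self_add
        · exact (not_lt.1 h).trans le_add_self
    _ = avgNorm volume ({y | t < ‖f y‖ₑ}.indicator f) R + (volume R)⁻¹ * volume R * t := by
        rw [lintegral_add_right _ measurable_const, setLIntegral_const, avgNorm]; ring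
    _ ≤ maximalFn ({y | t < ‖f y‖ₑ}.indicator f) x + 1 * t := by
        gcongr
        · exact avgNorm_le_maximalFn hR hxR
        · exact ENNReal.inv_mul_le_one _
    _ = _ := by rw [one_mul]

/-- The part of `f` with `|f| ≤ t` adds at most `t` to `Mf`, so only the large values are charged.
-/
lemma mul_volume_two_mul_lt_maximalFn_le (hn : 1 ≤ n) (f : (Fin n → ℝ) → ℝ) (t : ℝ≥0∞) :
    t * volume {x | 2 * t < maximalFn f x} ≤
      4 ^ n * ∫⁻ x, ‖{y | t < ‖f y‖ₑ}.indicator f x‖ₑ := by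
  refine le_trans ?_ (mul_volume_lt_maximalFn_le hn _ t)
  refine mul_le_mul_right (measure_mono fun x hx => ?_) _
  have := (show 2 * t < maximalFn f x from hx).trans_le (maximalFn_le_indicator_add f t x)
  rw [two_mul] at this
  exact lt_of_add_lt_add_right this

/-- Otherwise `Mf > γ` almost everywhere on `Q`, and the weak type inequality at height `γ` is
violated. -/
lemma essInfMaximal_le_of_lt (hn : 1 ≤ n) {Q : Set (Fin n → ℝ)} (hQ : MeasurableSet Q) {γ : ℝ≥0∞}
    (h : 4 ^ n * ∫⁻ x, ‖f x‖ₑ < γ * volume Q) : essInfMaximal f Q ≤ γ := by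
  by_contra! hlt
  refine absurd ?_ (not_le.2 h)
  refine le_trans ?_ (mul_volume_lt_maximalFn_le hn f γ)
  refine mul_le_mul_right (measure_mono_ae ?_) _
  have : ∀ᵐ x ∂volume.restrict Q, essInfMaximal f Q ≤ maximalFn f x := ae_essInf_le
  filter_upwards [(ae_restrict_iff' hQ).1 this] with x hx hxQ
  exact hlt.trans_le (hx hxQ)

lemma meanOsc_le_two_mul_avgNorm {X : Type*} [MeasurableSpace X] {μ : Measure X} {f : X → ℝ}
    {R : Set X} (hf : IntegrableOn f R μ) (h0 : μ R ≠ 0) (htop : μ R ≠ ∞) (c : ℝ) :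
    meanOsc μ f R ≤ 2 * avgNorm μ (fun y => f y - c) R := by
  have hmean : ⨍ z in R, (f z - c) ∂μ = ⨍ z in R, f z ∂μ - c := by
    have : IsFiniteMeasure (μ.restrict R) := ⟨by simpa using htop.lt_top⟩
    have hc : Integrable (fun _ => c) (μ.restrict R) := integrable_const c
    have hr : μ.real R ≠ 0 := ENNReal.toReal_ne_zero.2 ⟨h0, htop⟩
    rw [setAverage_eq, setAverage_eq, integral_sub hf hc, smul_sub, setIntegral_const, smul_smul,
      inv_mul_cancel₀ hr, one_smul]
  have hd := enorm_setAverage_le_avgNorm (μ := μ) (fun y => f y - c) h0 htop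
  calc meanOsc μ f R ≤ (μ R)⁻¹ * ∫⁻ y in R, (‖f y - c‖ₑ + ‖⨍ z in R, (f z - c) ∂μ‖ₑ) ∂μ := by
        unfold meanOsc
        gcongr with y
        calc ‖f y - ⨍ z in R, f z ∂μ‖ₑ = ‖(f y - c) - ⨍ z in R, (f z - c) ∂μ‖ₑ := by
              rw [hmean]; ring_nf
          _ ≤ _ := enorm_sub_le
    _ = avgNorm μ (fun y => f y - c) R + (μ R)⁻¹ * μ R * ‖⨍ z in R, (f z - c) ∂μ‖ₑ := by
        rw [lintegral_add_right _ measurable_const, setLIntegral_const, avgNorm]; ring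
    _ ≤ avgNorm μ (fun y => f y - c) R + 1 * avgNorm μ (fun y => f y - c) R := by
        gcongr; exact ENNReal.inv_mul_le_one _
    _ = _ := by ring

/-- Cubes around `x` of radius at most `ρ` see only the tripled ball; a larger one, once tripled,
contains the whole ball and is seen from each of its points. -/
lemma maximalFn_le_max_indicator {c : Fin n → ℝ} {ρ : ℝ} (hρ : 0 < ρ)
    {x : Fin n → ℝ} (hx : x ∈ Metric.closedBall c ρ) :
    maximalFn f x ≤ max (maximalFn ((Metric.closedBall c (3 * ρ)).indicator f) x)
      (3 ^ n * ⨅ y ∈ Metric.closedBall c ρ, maximalFn f y) := by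
  refine iSup_le fun S => iSup_le fun hS => iSup_le fun hxS => ?_
  obtain ⟨d, σ, hσ, rfl⟩ := hS
  rw [Metric.mem_closedBall] at hx
  have hxS' := hxS
  rw [Metric.mem_closedBall] at hxS'
  rcases le_or_gt σ ρ with h | h
  · refine le_max_of_le_left ?_
    have hsub : Metric.closedBall d σ ⊆ Metric.closedBall c (3 * ρ) := by
      intro y hy
      rw [Metric.mem_closedBall] at hy ⊢
      have h1 := dist_triangle_right y x d
      have h2 := dist_triangle y x c
      linarith
    refine le_trans (le_of_eq ?_) (avgNorm_le_maximalFn (isCube_closedBall d hσ) hxS)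
    unfold avgNorm
    congr 1
    exact setLIntegral_congr_fun Metric.isClosed_closedBall.measurableSet fun y hy => by
      simp only [indicator_of_mem (hsub hy)]
  · refine le_max_of_le_right ?_
    refine (inv_mul_lintegral_le_of_subset (κ := 3 ^ n)
      (Metric.closedBall_subset_closedBall (show σ ≤ 3 * σ by linarith))
      (volume_closedBall_pos d hσ) (volume_closedBall_ne_top _ _) ?_ _).trans ?_
    · rw [volume_closedBall_mul d d hσ.le (by norm_num)]; simp
    · refine mul_le_mul_right (le_iInf₂ fun y hy => ?_) _
      refine avgNorm_le_maximalFn (isCube_closedBall d (by positivity)) ?_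
      rw [Metric.mem_closedBall] at hy ⊢
      have h1 := dist_triangle_right y x c
      have h2 := dist_triangle y x d
      linarith

end WeakType

/-! ### A discrete logarithm of the maximal function: bounded oscillation and `L log L`. -/

section LevelCount

variable {n : ℕ} {g f w : (Fin n → ℝ) → ℝ} {a : ℝ≥0∞}

/-- The number of the thresholds `a, 2 a, 4 a, …` exceeded by the maximal function of `g`; this is
`log⁺ (M g / a)` up to bounded factors and errors. -/
noncomputable def levelCount (g : (Fin n → ℝ) → ℝ) (a : ℝ≥0∞) (x : Fin n → ℝ) : ℝ≥0∞ :=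
  ∑' k : ℕ, {y | a * 2 ^ k < maximalFn g y}.indicator 1 x

lemma measurableSet_lt_maximalFn (g : (Fin n → ℝ) → ℝ) (t : ℝ≥0∞) :
    MeasurableSet {y | t < maximalFn g y} := (isOpen_lt_maximalFn g t).measurableSet

lemma measurable_levelCount (g : (Fin n → ℝ) → ℝ) (a : ℝ≥0∞) : Measurable (levelCount g a) :=
  Measurable.tsum fun _ => measurable_one.indicator (measurableSet_lt_maximalFn g _)

/-- The weak type inequality at height `a 2^k` gives superlevel sets of measure at most `2^{-k} V`,
a geometric series. -/
lemma lintegral_levelCount_le (hn : 1 ≤ n) (ha : a ≠ 0) (ha' : a ≠ ∞) {V : ℝ≥0∞}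
    (h : 4 ^ n * ∫⁻ x, ‖g x‖ₑ ≤ a * V) : ∫⁻ x, levelCount g a x ≤ 2 * V := by
  have hk : ∀ k : ℕ, volume {y | a * 2 ^ k < maximalFn g y} ≤ 2⁻¹ ^ k * V := by
    intro k
    have h1 := (mul_volume_lt_maximalFn_le hn g (a * 2 ^ k)).trans h
    rw [mul_assoc, ENNReal.mul_le_mul_iff_right ha ha'] at h1
    calc volume {y | a * 2 ^ k < maximalFn g y}
        = 2⁻¹ ^ k * (2 ^ k * volume {y | a * 2 ^ k < maximalFn g y}) := by
          rw [← mul_assoc, ← mul_pow, ENNReal.inv_mul_cancel (by simp) (by simp), one_pow, one_mul]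
      _ ≤ _ := by gcongr
  calc ∫⁻ x, levelCount g a x = ∑' k : ℕ, volume {y | a * 2 ^ k < maximalFn g y} := by
        unfold levelCount
        rw [lintegral_tsum fun k =>
          (measurable_one.indicator (measurableSet_lt_maximalFn g _)).aemeasurable]
        exact tsum_congr fun k => lintegral_indicator_one (measurableSet_lt_maximalFn g _)
    _ ≤ ∑' k : ℕ, 2⁻¹ ^ k * V := ENNReal.tsum_le_tsum hk
    _ = 2 * V := by rw [ENNReal.tsum_mul_right, ENNReal.tsum_geometric_two]

lemma ENNReal.exists_le_mul_two_pow (ha : a ≠ 0) {u : ℝ≥0∞} (hu : u ≠ ∞) :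
    ∃ k : ℕ, u ≤ a * 2 ^ k := by
  obtain ⟨m, hm⟩ := ENNReal.exists_nat_mul_gt ha hu
  refine ⟨m, hm.le.trans ?_⟩
  rw [mul_comm]
  gcongr
  exact_mod_cast Nat.lt_two_pow_self.le

/-- When `2 a < u < ∞`, the term of the largest threshold below `u`, doubled, already dominates `u`.
-/
lemma ENNReal.le_add_tsum_threshold (ha : a ≠ 0) (u : ℝ≥0∞) :
    u ≤ 2 * a + 2 * ∑' k : ℕ, if a * 2 ^ (k + 1) < u then a * 2 ^ (k + 1) else 0 := by
  rcases eq_or_ne a ∞ with rfl | ha'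
  · simp
  rcases eq_or_ne u ∞ with rfl | hu
  · have : ∑' k : ℕ, (if a * 2 ^ (k + 1) < ∞ then a * 2 ^ (k + 1) else 0) = ∞ := by
      refine top_unique ((ENNReal.tsum_const_eq_top_of_ne_zero (α := ℕ) ha).ge.trans ?_)
      refine ENNReal.tsum_le_tsum fun k => ?_
      rw [if_pos (ENNReal.mul_lt_top ha'.lt_top (by simp))]
      exact le_mul_of_one_le_right' (one_le_pow₀ (by norm_num))
    simp [this]
  · classical
    have hex := ENNReal.exists_le_mul_two_pow ha hu
    rcases hm : Nat.find hex with _ | _ | k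
    · have := Nat.find_spec hex
      rw [hm] at this
      refine this.trans (le_add_right ?_)
      rw [pow_zero, mul_one, two_mul]; exact le_self_add
    · have := Nat.find_spec hex
      rw [hm] at this
      refine this.trans (le_add_right ?_)
      rw [zero_add, pow_one, mul_comm]
    · have h1 := Nat.find_spec hex
      have h2 : ¬ u ≤ a * 2 ^ (k + 1) := Nat.find_min hex (by lia)
      rw [hm] at h1
      refine le_add_left ?_
      calc u ≤ a * 2 ^ (k + 1 + 1) := h1
        _ = 2 * (if a * 2 ^ (k + 1) < u then a * 2 ^ (k + 1) else 0) := by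
            rw [if_pos (not_le.1 h2)]; ring
        _ ≤ _ := by
            gcongr
            exact ENNReal.le_tsum (f := fun k : ℕ =>
              if a * 2 ^ (k + 1) < u then a * 2 ^ (k + 1) else 0) k

/-- An `L log L` bound for the maximal function. -/
lemma setLIntegral_maximalFn_le (hn : 1 ≤ n) (ha : a ≠ 0) (hg : LocallyIntegrable g volume)
    (Q : Set (Fin n → ℝ)) :
    ∫⁻ x in Q, maximalFn g x ≤
      2 * a * volume Q + 4 * 4 ^ n * ∫⁻ x, ‖g x‖ₑ * levelCount g a x := by
  have hms := fun k : ℕ => measurableSet_lt_maximalFn g (a * 2 ^ k)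
  have hterm : ∀ k : ℕ, a * 2 ^ (k + 1) * volume {x | a * 2 ^ (k + 1) < maximalFn g x} ≤
      2 * 4 ^ n * ∫⁻ x, ‖g x‖ₑ * {y | a * 2 ^ k < maximalFn g y}.indicator 1 x := by
    intro k
    have h1 := mul_volume_two_mul_lt_maximalFn_le hn g (a * 2 ^ k)
    calc a * 2 ^ (k + 1) * volume {x | a * 2 ^ (k + 1) < maximalFn g x}
        = 2 * (a * 2 ^ k * volume {x | 2 * (a * 2 ^ k) < maximalFn g x}) := by
          rw [show a * 2 ^ (k + 1) = 2 * (a * 2 ^ k) by ring]; ring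
      _ ≤ 2 * (4 ^ n * ∫⁻ x, ‖{y | a * 2 ^ k < ‖g y‖ₑ}.indicator g x‖ₑ) := by gcongr
      -- Where `|g|` exceeds a threshold so does `Mg`, almost everywhere. The sum over thresholds
      -- then becomes `levelCount`.
      _ ≤ 2 * (4 ^ n * ∫⁻ x, ‖g x‖ₑ * {y | a * 2 ^ k < maximalFn g y}.indicator 1 x) := by
          gcongr 2 * (4 ^ n * ?_)
          refine lintegral_mono_ae ?_
          filter_upwards [ae_enorm_le_maximalFn hg] with x hx
          by_cases h : a * 2 ^ k < ‖g x‖ₑ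
          · rw [indicator_of_mem (show x ∈ {y | a * 2 ^ k < ‖g y‖ₑ} from h),
              indicator_of_mem (show x ∈ {y | a * 2 ^ k < maximalFn g y} from h.trans_le hx)]
            simp
          · rw [indicator_of_notMem (show x ∉ {y | a * 2 ^ k < ‖g y‖ₑ} from h)]
            simp
      _ = _ := by ring
  calc ∫⁻ x in Q, maximalFn g x
      ≤ ∫⁻ x in Q, (2 * a + 2 * ∑' k : ℕ,
          {y | a * 2 ^ (k + 1) < maximalFn g y}.indicator (fun _ => a * 2 ^ (k + 1)) x) := by
        refine lintegral_mono fun x => (ENNReal.le_add_tsum_threshold ha _).trans (le_of_eq ?_)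
        simp only [indicator_apply, mem_ofPred_eq]
    _ = 2 * a * volume Q + 2 * ∑' k : ℕ, ∫⁻ x in Q,
          {y | a * 2 ^ (k + 1) < maximalFn g y}.indicator (fun _ => a * 2 ^ (k + 1)) x := by
        rw [lintegral_add_left measurable_const, setLIntegral_const,
          lintegral_const_mul' _ _ (by simp), lintegral_tsum fun k =>
            (measurable_const.indicator (hms (k + 1))).aemeasurable]
    _ ≤ 2 * a * volume Q + 2 * ∑' k : ℕ, 2 * 4 ^ n *
          ∫⁻ x, ‖g x‖ₑ * {y | a * 2 ^ k < maximalFn g y}.indicator 1 x := by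
        gcongr with k
        refine le_trans ?_ (hterm k)
        refine (setLIntegral_le_lintegral _ _).trans ?_
        rw [lintegral_indicator_const (hms (k + 1))]
    _ = 2 * a * volume Q + 4 * 4 ^ n * ∫⁻ x, ‖g x‖ₑ * levelCount g a x := by
        simp_rw [levelCount, ← ENNReal.tsum_mul_left]
        rw [lintegral_tsum fun k => ?_]
        · rw [ENNReal.tsum_mul_left, ENNReal.tsum_mul_left]; ring
        · exact (hg.aestronglyMeasurable.enorm.mul
            (measurable_one.indicator (hms k)).aemeasurable)

lemma ENNReal.enorm_toReal_sub_natCast_le {F b : ℝ≥0∞} {m : ℕ} (hF : F ≠ ∞) (h1 : F ≤ m + b)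
    (h2 : (m : ℝ≥0∞) ≤ F + b) : ‖F.toReal - m‖ₑ ≤ b := by
  rcases eq_or_ne b ∞ with rfl | hb
  · exact le_top
  lift F to ℝ≥0 using hF
  lift b to ℝ≥0 using hb
  have h1' : (F : ℝ) ≤ m + b := by exact_mod_cast h1
  have h2' : (m : ℝ) ≤ F + b := by exact_mod_cast h2
  rw [Real.enorm_eq_ofReal_abs, ENNReal.coe_toReal, ← ENNReal.ofReal_coe_nnreal]
  refine ENNReal.ofReal_le_ofReal ?_
  rw [abs_le]; constructor <;> linarith

/-- On a cube the counting function differs from a constant by a function with bounded mean. -/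
lemma exists_avgNorm_levelCount_sub_le (hn : 1 ≤ n) (ha : a ≠ 0) (ha' : a ≠ ∞)
    (hg : ∫⁻ x, ‖g x‖ₑ ≠ ∞) (hfin : ∀ᵐ x, levelCount g a x ≠ ∞) {R : Set (Fin n → ℝ)}
    (hR : IsCube R) :
    ∃ c : ℝ, avgNorm volume (fun x => (levelCount g a x).toReal - c) R ≤ 2 * n + 2 * 3 ^ n := by
  obtain ⟨z, ρ, hρ, rfl⟩ := hR
  set R := Metric.closedBall z ρ with hR
  set R3 := Metric.closedBall z (3 * ρ) with hR3
  set A := ⨅ y ∈ R, maximalFn g y with hA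
  have hRm : MeasurableSet R := Metric.isClosed_closedBall.measurableSet
  have hR0 : volume R ≠ 0 := volume_closedBall_pos z hρ
  have hRt : volume R ≠ ∞ := volume_closedBall_ne_top z ρ
  have hAtop : A ≠ ∞ := by
    intro h
    refine hR0 (measure_mono_null (fun y hy => ?_) (ae_iff.1 (ae_maximalFn_ne_top hn hg)))
    have : A ≤ maximalFn g y := iInf₂_le y hy
    rw [h] at this
    simpa using top_unique this
  -- The constant subtracted is the first index `m` with `4 ^ n A ≤ a 2 ^ m`, roughly `log₂ (A /
  -- a)`. The factor `4 ^ n` dominates the `3 ^ n` of localization, matches the weak type constant,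
  -- and is the power `2 ^ (2 n)` of two.
  have hex := ENNReal.exists_le_mul_two_pow ha (ENNReal.mul_ne_top (by simp) hAtop :
    (4 : ℝ≥0∞) ^ n * A ≠ ∞)
  classical
  set m := Nat.find hex with hm
  have hm1 : 4 ^ n * A ≤ a * 2 ^ m := Nat.find_spec hex
  have hm2 : ∀ k < m, a * 2 ^ k < 4 ^ n * A := fun k hk => not_le.1 (Nat.find_min hex hk)
  set G := levelCount (R3.indicator g) (a * 2 ^ m) with hG
  refine ⟨m, ?_⟩
  have hmass : 4 ^ n * ∫⁻ x, ‖R3.indicator g x‖ₑ ≤ a * 2 ^ m * (3 ^ n * volume R) := by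
    have h1 : ∫⁻ x, ‖R3.indicator g x‖ₑ = ∫⁻ x in R3, ‖g x‖ₑ := by
      simp_rw [enorm_indicator_eq_indicator_enorm]
      rw [lintegral_indicator Metric.isClosed_closedBall.measurableSet]
    have h3 : avgNorm volume g R3 ≤ A := le_iInf₂ fun y hy =>
      avgNorm_le_maximalFn (isCube_closedBall z (by positivity))
        (Metric.closedBall_subset_closedBall (by linarith) hy)
    have h4 : ∫⁻ x in R3, ‖g x‖ₑ = volume R3 * avgNorm volume g R3 := by
      rw [avgNorm, ← mul_assoc, ENNReal.mul_inv_cancel (volume_closedBall_pos z (by positivity))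
        (volume_closedBall_ne_top _ _), one_mul]
    have h5 : volume R3 = 3 ^ n * volume R := by
      rw [hR3, volume_closedBall_mul z z hρ.le (by norm_num)]; simp [hR]
    rw [h1, h4, h5]
    calc 4 ^ n * (3 ^ n * volume R * avgNorm volume g R3)
        ≤ 4 ^ n * (3 ^ n * volume R * A) := by gcongr
      _ = 4 ^ n * A * (3 ^ n * volume R) := by ring
      _ ≤ _ := by gcongr
  have hGint := lintegral_levelCount_le hn (mul_ne_zero ha (by simp))
    (ENNReal.mul_ne_top ha' (by simp)) hmass
  -- Thresholds from index `m` on exceed `3 ^ n A`, so `Mg` can pass them only through the part of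
  -- `g` in the tripled cube.
  have hupper : ∀ x ∈ R, levelCount g a x ≤ m + G x := by
    intro x hx
    rw [levelCount, ← ENNReal.summable.sum_add_tsum_nat_add' (k := m)]
    gcongr ?_ + ?_
    · calc _ ≤ ∑ k ∈ Finset.range m, (1 : ℝ≥0∞) :=
            Finset.sum_le_sum fun k _ => indicator_le_self' (by simp) x
        _ = m := by simp
    · refine ENNReal.tsum_le_tsum fun k => ?_
      by_cases h : a * 2 ^ (k + m) < maximalFn g x
      · refine (indicator_le_self' (by simp) x).trans (le_of_eq ?_)
        refine (indicator_of_mem (s := {y | a * 2 ^ m * 2 ^ k < maximalFn (R3.indicator g) y})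
          ?_ _).symm
        rw [mem_ofPred_eq, mul_assoc, ← pow_add, add_comm m k]
        refine h.trans_le ((le_max_iff.1 (maximalFn_le_max_indicator hρ hx)).resolve_right ?_)
        rw [not_le]
        calc 3 ^ n * A ≤ 4 ^ n * A := by gcongr; norm_num
          _ ≤ a * 2 ^ m := hm1
          _ ≤ a * 2 ^ (k + m) := by gcongr; exacts [by norm_num, Nat.le_add_left m k]
          _ < _ := h
      · rw [indicator_of_notMem (show x ∉ {y | a * 2 ^ (k + m) < maximalFn g y} from h)]
        exact zero_le
  -- Minimality of `m` gives `a 2 ^ k < A` for `k < m - 2 n`, so these thresholds are passed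
  -- everywhere on `R`.
  have hlower : ∀ x ∈ R, (m : ℝ≥0∞) ≤ levelCount g a x + 2 * n := by
    intro x hx
    have hAx : A ≤ maximalFn g x := iInf₂_le x hx
    have h1 : ((m - 2 * n : ℕ) : ℝ≥0∞) ≤ levelCount g a x := by
      refine le_trans (le_of_eq ?_) (ENNReal.sum_le_tsum (Finset.range (m - 2 * n)))
      rw [Finset.sum_congr rfl (g := fun _ => (1 : ℝ≥0∞))]
      · simp
      · intro k hk
        rw [Finset.mem_range] at hk
        refine indicator_of_mem ?_ _
        have h2 := hm2 (k + 2 * n) (by lia)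
        rw [pow_add, pow_mul, show (2 : ℝ≥0∞) ^ 2 = 4 by norm_num, ← mul_assoc,
          mul_comm _ ((4 : ℝ≥0∞) ^ n), ENNReal.mul_lt_mul_iff_right (by simp) (by simp)] at h2
        exact h2.trans_le hAx
    calc (m : ℝ≥0∞) ≤ ((m - 2 * n + 2 * n : ℕ) : ℝ≥0∞) := by exact_mod_cast (by lia)
      _ = ((m - 2 * n : ℕ) : ℝ≥0∞) + 2 * n := by push_cast; rfl
      _ ≤ _ := by gcongr
  calc avgNorm volume (fun x => (levelCount g a x).toReal - m) R
      ≤ (volume R)⁻¹ * ∫⁻ x in R, (2 * n + G x) := by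
        unfold avgNorm
        gcongr (volume R)⁻¹ * ?_
        refine lintegral_mono_ae ?_
        filter_upwards [ae_restrict_mem hRm, ae_restrict_of_ae hfin] with x hx hxfin
        refine ENNReal.enorm_toReal_sub_natCast_le hxfin ((hupper x hx).trans ?_)
          ((hlower x hx).trans ?_)
        · gcongr; exact le_add_self
        · gcongr; exact le_self_add
    _ ≤ (volume R)⁻¹ * (2 * n * volume R + 2 * (3 ^ n * volume R)) := by
        rw [lintegral_add_left measurable_const, setLIntegral_const]
        gcongr
        exact (setLIntegral_le_lintegral _ _).trans hGint
    _ = (volume R)⁻¹ * volume R * (2 * n + 2 * 3 ^ n) := by ring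
    _ = _ := by rw [ENNReal.inv_mul_cancel hR0 hRt, one_mul]

end LevelCount

/-! ### The converse: test functions and recovery of the Fujii–Wilson constant. -/

section Converse

variable {n : ℕ} {f w : (Fin n → ℝ) → ℝ}

lemma volume_univ_pi_eq_top (hn : 1 ≤ n) : volume (univ : Set (Fin n → ℝ)) = ∞ := by
  have : Nonempty (Fin n) := ⟨⟨0, hn⟩⟩
  rw [volume_pi, Measure.pi_univ]
  simp only [Real.volume_univ, Finset.prod_const, Finset.card_univ, Fintype.card_fin]
  exact ENNReal.top_pow (by lia)

lemma exists_maximalFn_ne_top (hn : 1 ≤ n) (hf : Integrable f volume) :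
    ∃ x, maximalFn f x ≠ ∞ :=
  (ae_maximalFn_ne_top hn hf.2.ne).exists

lemma Integrable.eq_zero_of_ae_eq_const (hn : 1 ≤ n) (hf : Integrable f volume) {c : ℝ}
    (h : ∀ᵐ x, f x = c) : c = 0 := by
  have hc : Integrable (fun _ : Fin n → ℝ => c) volume := hf.congr h
  refine (integrable_const_iff.1 hc).resolve_right fun hfin => ?_
  exact (measure_lt_top volume univ).ne (volume_univ_pi_eq_top hn)

/-- An integrable function that does not vanish almost everywhere is admissible. -/
lemma isAdmissible_of_integrable (hn : 1 ≤ n) (hf : Integrable f volume)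
    (h0 : ¬ ∀ᵐ x, f x = 0) : IsAdmissible f where
  locallyIntegrable := hf.locallyIntegrable
  nonconstant := fun ⟨c, hc⟩ => h0 (by
    have := Integrable.eq_zero_of_ae_eq_const hn hf hc
    rwa [this] at hc)
  maximalFn_finite := exists_maximalFn_ne_top hn hf

lemma weightedLpRatio_one (Q : Set (Fin n → ℝ)) :
    weightedLpRatio w f 1 Q = (weightMass w Q)⁻¹ *
      ∫⁻ x in Q, (maximalFn f x - essInfMaximal f Q) / sharpMaximalFn f x *
        ENNReal.ofReal (w x) := by
  simp [weightedLpRatio]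

lemma lintegral_ratio_le (hw : IsWeight w) (a : Fin n → ℝ) {r : ℝ} (hr : 0 < r) {D : ℝ≥0∞}
    (h : weightedLpRatio w f 1 (Metric.closedBall a r) ≤ D) :
    ∫⁻ x in Metric.closedBall a r,
      (maximalFn f x - essInfMaximal f (Metric.closedBall a r)) / sharpMaximalFn f x *
        ENNReal.ofReal (w x) ≤ D * weightMass w (Metric.closedBall a r) := by
  rw [weightedLpRatio_one] at h
  have h0 := (hw.mass_pos _ (isCube_closedBall a hr)).ne'
  have ht := hw.mass_ne_top a r
  rwa [mul_comm, ← ENNReal.le_div_iff_mul_le (Or.inl (ENNReal.inv_ne_zero.2 ht))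
    (Or.inl (ENNReal.inv_ne_top.2 h0)), div_eq_mul_inv, inv_inv] at h

lemma sharpMaximalFn_le_of_forall {β : ℝ≥0∞}
    (h : ∀ R, IsCube R → meanOsc volume f R ≤ β) (x : Fin n → ℝ) : sharpMaximalFn f x ≤ β :=
  iSup_le fun R => iSup_le fun hR => iSup_le fun _ => h R hR

/-- Any constant in the weighted estimate is bounded below. -/
lemma one_le_of_forall_weightedLpRatio_le (hn : 1 ≤ n) (hw : IsWeight w) {D : ℝ≥0∞}
    (h : ∀ f : (Fin n → ℝ) → ℝ, IsAdmissible f → ∀ Q : Set (Fin n → ℝ), IsCube Q →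
      weightedLpRatio w f 1 Q ≤ D) : 1 ≤ 4 * 16 ^ n * D := by
  set Q : Set (Fin n → ℝ) := Metric.closedBall 0 1 with hQ
  set φ := dyadicIndex (0 : Fin n → ℝ) 1 with hφdef
  have hφ : IsRefining φ := isRefining_dyadicIndex 0 1
  set W := weightMass w Q with hW
  have hQcube : IsCube Q := isCube_closedBall 0 one_pos
  have hW0 : W ≠ 0 := (hw.mass_pos Q hQcube).ne'
  have hWt : W ≠ ∞ := hw.mass_ne_top 0 1
  have hQ0 : volume Q ≠ 0 := volume_closedBall_pos 0 one_pos
  have hQt : volume Q ≠ ∞ := volume_closedBall_ne_top 0 1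
  have htopm := hφ.measurableSet_levelCell 0 (0 : Fin n → ℝ)
  have hae : levelCell φ 0 0 =ᵐ[volume] Q := topCell_ae_eq 0 one_pos
  -- Test with the indicator of a cell `P` of side `1/16` of that of `Q`: the ratio is at least
  -- `1/4` on `P`, so `w(P) ≤ 4 D w(Q)`. The bound is written as a multiple of `|P|` so that it can
  -- be summed over cells.
  have hcell : ∀ x ∈ levelCell φ 0 0, ∫⁻ _ in levelCell φ 4 x, 1 ∂(weightMeasure w) ≤
      (4 * 16 ^ n * D * W * (volume Q)⁻¹) * ∫⁻ _ in levelCell φ 4 x, 1 := by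
    intro x hx
    set P := levelCell φ 4 x with hP
    have hPm : MeasurableSet P := hφ.measurableSet_levelCell 4 x
    have hPQ : P ⊆ Q := by
      have h1 := hφ.levelCell_subset (Nat.zero_le 4) x
      rw [levelCell_eq_of_mem hx] at h1
      exact h1.trans (topCell_subset 0 one_pos)
    have hP0 : volume P ≠ 0 := volume_levelCell_ne_zero 0 one_pos 4 x
    have hPt : volume P ≠ ∞ := volume_levelCell_ne_top 0 one_pos 4 x
    have hvol : volume Q = 16 ^ n * volume P := by
      have := volume_levelCell_eq_mul (0 : Fin n → ℝ) one_pos 4 x 0 (t := 16) (by norm_num)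
      rw [show (16 : ℝ) * (1 / 2 ^ 4) = 1 by norm_num] at this
      rw [ENNReal.ofReal_ofNat] at this
      exact this
    set f : (Fin n → ℝ) → ℝ := P.indicator 1 with hf
    have hfint : Integrable f volume :=
      (integrable_indicator_iff hPm).2 (integrableOn_const hPt)
    have hfenorm : ∀ y, ‖f y‖ₑ = P.indicator 1 y := by
      intro y; by_cases hy : y ∈ P <;> simp [hf, hy]
    have hfnorm : ∫⁻ y, ‖f y‖ₑ = volume P := by
      simp_rw [hfenorm]; exact lintegral_indicator_one hPm
    have hadm : IsAdmissible f := by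
      refine isAdmissible_of_integrable hn hfint fun h0 => hP0 ?_
      rw [← hfnorm]
      exact lintegral_eq_zero_of_ae_eq_zero (by filter_upwards [h0] with y hy; simp [hy])
    -- The choice of level `4` is used here: the weak type inequality needs `4 ^ n < 16 ^ n / 2`,
    -- while one level less would fail for `n = 1`.
    have hess : essInfMaximal f Q ≤ 2⁻¹ := by
      refine essInfMaximal_le_of_lt hn Metric.isClosed_closedBall.measurableSet ?_
      rw [hfnorm, hvol, ← mul_assoc]
      refine (ENNReal.mul_lt_mul_iff_left hP0 hPt).2 ?_
      have h4 : (4 : ℝ≥0∞) ≤ 4 ^ n := le_self_pow₀ (by norm_num) (by lia)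
      calc (4 : ℝ≥0∞) ^ n = 4 ^ n * 1 := (mul_one _).symm
        _ < 4 ^ n * (2⁻¹ * 4) := by
            refine (ENNReal.mul_lt_mul_iff_right (by simp) (by simp)).2 ?_
            rw [show (4 : ℝ≥0∞) = 2 * 2 by norm_num, ← mul_assoc,
              ENNReal.inv_mul_cancel (by simp) (by simp)]
            norm_num
        _ ≤ 4 ^ n * (2⁻¹ * 4 ^ n) := by gcongr
        _ = 2⁻¹ * 16 ^ n := by rw [show (16 : ℝ≥0∞) = 4 * 4 by norm_num, mul_pow]; ring
    have hsharp : ∀ y, sharpMaximalFn f y ≤ 2 := by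
      refine sharpMaximalFn_le_of_forall fun R hR => ?_
      obtain ⟨c, ρ, hρ, rfl⟩ := hR
      refine (meanOsc_le_two_mul_avgNorm hfint.integrableOn (volume_closedBall_pos c hρ)
        (volume_closedBall_ne_top _ _) 0).trans ?_
      have : avgNorm volume (fun y => f y - 0) (Metric.closedBall c ρ) ≤ 1 := by
        calc avgNorm volume (fun y => f y - 0) (Metric.closedBall c ρ)
            ≤ (volume (Metric.closedBall c ρ))⁻¹ * ∫⁻ _ in Metric.closedBall c ρ, 1 := by
              unfold avgNorm
              gcongr with y
              simp only [sub_zero, hfenorm]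
              exact indicator_le_self' (by simp) y
          _ ≤ 1 := by rw [setLIntegral_one]; exact ENNReal.inv_mul_le_one _
      calc 2 * avgNorm volume (fun y => f y - 0) (Metric.closedBall c ρ) ≤ 2 * 1 := by gcongr
        _ = 2 := mul_one 2
    have hratio : ∀ᵐ y, y ∈ P → (4 : ℝ≥0∞)⁻¹ ≤
        (maximalFn f y - essInfMaximal f Q) / sharpMaximalFn f y := by
      filter_upwards [ae_enorm_le_maximalFn hfint.locallyIntegrable] with y hy hyP
      rw [hfenorm, indicator_of_mem hyP] at hy
      have h1 : (2 : ℝ≥0∞)⁻¹ ≤ maximalFn f y - essInfMaximal f Q := by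
        calc (2 : ℝ≥0∞)⁻¹ = 1 - 2⁻¹ := ENNReal.one_sub_inv_two.symm
          _ ≤ _ := tsub_le_tsub hy hess
      calc (4 : ℝ≥0∞)⁻¹ = 2⁻¹ / 2 := by
            rw [div_eq_mul_inv, ← ENNReal.mul_inv (by simp) (by simp)]; norm_num
        _ ≤ _ := ENNReal.div_le_div h1 (hsharp y)
    have hkey : 4⁻¹ * weightMass w P ≤ D * W := by
      refine le_trans ?_ (lintegral_ratio_le hw 0 one_pos (h f hadm Q hQcube))
      calc 4⁻¹ * weightMass w P = ∫⁻ y in P, 4⁻¹ * ENNReal.ofReal (w y) := by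
            rw [lintegral_const_mul' _ _ (by simp)]; rfl
        _ ≤ ∫⁻ y in P, (maximalFn f y - essInfMaximal f Q) / sharpMaximalFn f y *
              ENNReal.ofReal (w y) := by
            refine setLIntegral_mono_ae' hPm ?_
            filter_upwards [hratio] with y hy hyP
            gcongr
            exact hy hyP
        _ ≤ _ := lintegral_mono_set hPQ
    rw [setLIntegral_one, setLIntegral_one, weightMeasure_apply hPm]
    calc weightMass w P = 4 * (4⁻¹ * weightMass w P) := by
          rw [← mul_assoc, ENNReal.mul_inv_cancel (by simp) (by simp), one_mul]
      _ ≤ 4 * (D * W) := by gcongr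
      _ = 4 * (D * W) * (volume Q * (volume Q)⁻¹) := by
          rw [ENNReal.mul_inv_cancel hQ0 hQt, mul_one]
      _ = 4 * (D * W) * ((16 ^ n * volume P) * (volume Q)⁻¹) := by rw [← hvol]
      _ = _ := by ring
  -- Adding up over the cells of `Q` gives `w(Q) ≤ 4 * 16 ^ n * D * w(Q)`, and `w(Q)` cancels.
  have hsum := (hφ.isSaturated_levelCell (Nat.zero_le 4) 0).lintegral_le hφ hcell
  rw [setLIntegral_one, setLIntegral_one, weightMeasure_apply htopm, weightMass_congr_set hae,
    measure_congr hae, mul_assoc, ENNReal.inv_mul_cancel hQ0 hQt, mul_one] at hsum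
  refine (ENNReal.mul_le_mul_iff_left hW0 hWt).1 ?_
  rwa [one_mul]

/-- The test function `f` is the level count of `g = w χ_Q` at base `a = w(Q) / |Q|`. Since `f ≤ Mf
≤ γ + β · ratio` almost everywhere, the hypothesis bounds `∫ g f`, which is exactly the term left
over in the `L log L` bound for `∫_Q Mg`. -/
theorem lintegral_maximalFn_indicator_le_of_forall (hn : 1 ≤ n) (hw : IsWeight w) {D : ℝ≥0∞}
    (h : ∀ f : (Fin n → ℝ) → ℝ, IsAdmissible f → ∀ Q : Set (Fin n → ℝ), IsCube Q →
      weightedLpRatio w f 1 Q ≤ D) (z : Fin n → ℝ) {r : ℝ} (hr : 0 < r) :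
    ∫⁻ x in Metric.closedBall z r, maximalFn ((Metric.closedBall z r).indicator w) x ≤
      (2 + 4 * 4 ^ n * (4 * 16 ^ n + 2 * (2 * n + 2 * 3 ^ n) * D)) *
        weightMass w (Metric.closedBall z r) := by
  set Q := Metric.closedBall z r with hQ
  set g := Q.indicator w with hg
  set W := weightMass w Q with hW
  set V := volume Q with hV
  set β : ℝ≥0∞ := 2 * (2 * n + 2 * 3 ^ n) with hβ
  set γ : ℝ≥0∞ := 4 * 16 ^ n with hγ
  have hQcube : IsCube Q := isCube_closedBall z hr
  have hQm : MeasurableSet Q := Metric.isClosed_closedBall.measurableSet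
  have hW0 : W ≠ 0 := (hw.mass_pos Q hQcube).ne'
  have hWt : W ≠ ∞ := hw.mass_ne_top z r
  have hV0 : V ≠ 0 := volume_closedBall_pos z hr
  have hVt : V ≠ ∞ := volume_closedBall_ne_top z r
  set a := W / V with ha
  have ha0 : a ≠ 0 := (ENNReal.div_pos hW0 hVt).ne'
  have hat : a ≠ ∞ := ENNReal.div_ne_top hWt hV0
  have haV : a * V = W := ENNReal.div_mul_cancel hV0 hVt
  have hgint : Integrable g volume := (integrable_indicator_iff hQm).2
    (hw.locallyIntegrable.integrableOn_isCompact (isCompact_closedBall z r))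
  have hgenorm : ∀ᵐ x, ‖g x‖ₑ = Q.indicator (fun x => ENNReal.ofReal (w x)) x := by
    filter_upwards [hw.nonneg] with x hx
    rw [hg, enorm_indicator_eq_indicator_enorm]
    by_cases hxQ : x ∈ Q
    · simp only [indicator_of_mem hxQ, Real.enorm_of_nonneg hx]
    · simp only [indicator_of_notMem hxQ]
  have hgmass : ∫⁻ x, ‖g x‖ₑ = W := by
    rw [lintegral_congr_ae hgenorm, lintegral_indicator hQm]; rfl
  set F := levelCount g a with hF
  have hFint : ∫⁻ x, F x ≤ 2 * (4 ^ n * V) := by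
    refine lintegral_levelCount_le hn ha0 hat (le_of_eq ?_)
    rw [hgmass, ← haV]; ring
  have hFtop : ∫⁻ x, F x ≠ ∞ := ne_top_of_le_ne_top
    (ENNReal.mul_ne_top (by simp) (ENNReal.mul_ne_top (by simp) hVt)) hFint
  have hFm : Measurable F := measurable_levelCount g a
  have hFfin : ∀ᵐ x, F x ≠ ∞ := by
    filter_upwards [ae_lt_top hFm hFtop] with x hx using hx.ne
  set f : (Fin n → ℝ) → ℝ := fun x => (F x).toReal with hf
  have hfint : Integrable f volume := integrable_toReal_of_lintegral_ne_top hFm.aemeasurable hFtop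
  have hfF : ∀ᵐ x, ‖f x‖ₑ = F x := by
    filter_upwards [hFfin] with x hx
    rw [hf, Real.enorm_of_nonneg ENNReal.toReal_nonneg, ENNReal.ofReal_toReal hx]
  have hfmass : ∫⁻ x, ‖f x‖ₑ ≤ 2 * (4 ^ n * V) := by rwa [lintegral_congr_ae hfF]
  -- The integral of `f` is at most `2 * 4 ^ n * |Q|`, and the weak type inequality costs another `4
  -- ^ n`; `4` replaces `2` for a strict inequality.
  have hess : essInfMaximal f Q ≤ γ := by
    refine essInfMaximal_le_of_lt hn hQm ?_
    calc 4 ^ n * ∫⁻ x, ‖f x‖ₑ ≤ 4 ^ n * (2 * (4 ^ n * V)) := by gcongr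
      _ = 2 * (16 ^ n * V) := by
          rw [show (16 : ℝ≥0∞) = 4 * 4 by norm_num, mul_pow]; ring
      _ < 4 * (16 ^ n * V) := by
          refine (ENNReal.mul_lt_mul_iff_left (mul_ne_zero (by simp) hV0)
            (ENNReal.mul_ne_top (by simp) hVt)).2 (by norm_num)
      _ = γ * V := by rw [hγ]; ring
  have hβ0 : β ≠ 0 := by simp [hβ]
  have hβt : β ≠ ∞ := by
    rw [hβ]; exact ENNReal.mul_ne_top (by simp) (ENNReal.add_ne_top.2
      ⟨ENNReal.mul_ne_top (by simp) (by simp), ENNReal.mul_ne_top (by simp) (by simp)⟩)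
  have hsharp : ∀ x, sharpMaximalFn f x ≤ β := by
    refine sharpMaximalFn_le_of_forall fun R hR => ?_
    obtain ⟨c, hc⟩ := exists_avgNorm_levelCount_sub_le hn ha0 hat hgint.2.ne hFfin hR
    obtain ⟨y, ρ, hρ, rfl⟩ := hR
    exact (meanOsc_le_two_mul_avgNorm hfint.integrableOn (volume_closedBall_pos y hρ)
      (volume_closedBall_ne_top _ _) c).trans (mul_le_mul_right hc 2)
  have hmain : ∫⁻ x in Q, F x * ENNReal.ofReal (w x) ≤ (γ + β * D) * W := by
    -- A function vanishing almost everywhere is not admissible, but then the integral is zero.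
    by_cases hzero : ∀ᵐ x, f x = 0
    · have : ∀ᵐ x ∂volume.restrict Q, F x * ENNReal.ofReal (w x) = 0 := by
        refine ae_restrict_of_ae ?_
        filter_upwards [hzero, hfF] with x h0 h1
        rw [← h1, h0]; simp
      rw [lintegral_eq_zero_of_ae_eq_zero this]
      exact zero_le
    have hratio := lintegral_ratio_le hw z hr
      (h f (isAdmissible_of_integrable hn hfint hzero) Q hQcube)
    set ratio := fun x => (maximalFn f x - essInfMaximal f Q) / sharpMaximalFn f x with hrat
    have hpt : ∀ᵐ x, F x ≤ γ + β * ratio x := by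
      filter_upwards [hfF, ae_enorm_le_maximalFn hfint.locallyIntegrable] with x h1 h2
      calc F x ≤ maximalFn f x := h1 ▸ h2
        _ ≤ essInfMaximal f Q + (maximalFn f x - essInfMaximal f Q) := le_add_tsub
        _ = essInfMaximal f Q + β * ((maximalFn f x - essInfMaximal f Q) / β) := by
            rw [ENNReal.mul_div_cancel hβ0 hβt]
        _ ≤ γ + β * ratio x := by
            exact add_le_add hess (mul_le_mul_right (ENNReal.div_le_div_left (hsharp x) _) β)
    calc ∫⁻ x in Q, F x * ENNReal.ofReal (w x)
        ≤ ∫⁻ x in Q, (γ * ENNReal.ofReal (w x) + β * (ratio x * ENNReal.ofReal (w x))) := by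
          refine lintegral_mono_ae (ae_restrict_of_ae ?_)
          filter_upwards [hpt] with x hx
          calc F x * ENNReal.ofReal (w x) ≤ (γ + β * ratio x) * ENNReal.ofReal (w x) := by gcongr
            _ = _ := by ring
      _ = γ * W + β * ∫⁻ x in Q, ratio x * ENNReal.ofReal (w x) := by
          rw [lintegral_add_left' (hw.aemeasurable.restrict.const_mul γ),
            lintegral_const_mul' _ _ (by simp [hγ, ENNReal.mul_eq_top]),
            lintegral_const_mul' _ _ hβt]
          rfl
      _ ≤ γ * W + β * (D * W) := by gcongr
      _ = _ := by ring
  have hgF : ∫⁻ x, ‖g x‖ₑ * F x = ∫⁻ x in Q, F x * ENNReal.ofReal (w x) := by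
    rw [← lintegral_indicator hQm]
    refine lintegral_congr_ae ?_
    filter_upwards [hgenorm] with x hx
    rw [hx]
    by_cases hxQ : x ∈ Q
    · simp only [indicator_of_mem hxQ, mul_comm]
    · simp only [indicator_of_notMem hxQ, zero_mul]
  calc ∫⁻ x in Q, maximalFn g x
      ≤ 2 * a * V + 4 * 4 ^ n * ∫⁻ x, ‖g x‖ₑ * F x :=
        setLIntegral_maximalFn_le hn ha0 hgint.locallyIntegrable Q
    _ ≤ 2 * W + 4 * 4 ^ n * ((γ + β * D) * W) := by
        rw [hgF, mul_assoc, haV]; gcongr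
    _ = _ := by ring

theorem ainftyConst_le_of_forall (hn : 1 ≤ n) (hw : IsWeight w) {D : ℝ≥0∞}
    (h : ∀ f : (Fin n → ℝ) → ℝ, IsAdmissible f → ∀ Q : Set (Fin n → ℝ), IsCube Q →
      weightedLpRatio w f 1 Q ≤ D) :
    ainftyConst w ≤ ((2 + 4 * 4 ^ n * (4 * 16 ^ n)) * (4 * 16 ^ n) +
      4 * 4 ^ n * (2 * (2 * n + 2 * 3 ^ n))) * D := by
  refine iSup_le fun Q => iSup_le fun hQ => ?_
  have hQ' := hQ
  obtain ⟨z, r, hr, rfl⟩ := hQ'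
  set Q := Metric.closedBall z r with hQdef
  set β : ℝ≥0∞ := 2 * (2 * n + 2 * 3 ^ n) with hβ
  set γ : ℝ≥0∞ := 4 * 16 ^ n with hγ
  -- The bound obtained is affine in `D`; its constant term is multiplied by `γ D ≥ 1` to become
  -- linear.
  calc (weightMass w Q)⁻¹ * ∫⁻ x in Q, maximalFn (Q.indicator w) x
      ≤ (weightMass w Q)⁻¹ * ((2 + 4 * 4 ^ n * (γ + β * D)) * weightMass w Q) := by
        gcongr
        exact lintegral_maximalFn_indicator_le_of_forall hn hw h z hr
    _ = (2 + 4 * 4 ^ n * (γ + β * D)) * ((weightMass w Q)⁻¹ * weightMass w Q) := by ring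
    _ = (2 + 4 * 4 ^ n * γ) * 1 + 4 * 4 ^ n * β * D := by
        rw [ENNReal.inv_mul_cancel (hw.mass_pos Q hQ).ne' (hw.mass_ne_top z r)]; ring
    _ ≤ (2 + 4 * 4 ^ n * γ) * (γ * D) + 4 * 4 ^ n * β * D := by
        gcongr
        exact one_le_of_forall_weightedLpRatio_le hn hw h
    _ = _ := by ring

end Converse

theorem corollary2 (n : ℕ) (hn : 1 ≤ n) :
    (∃ c : ℝ, 0 < c ∧
      ∀ w : (Fin n → ℝ) → ℝ, IsWeight w → IsAinfty w →
      ∀ f : (Fin n → ℝ) → ℝ, IsAdmissible f →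
      ∀ Q : Set (Fin n → ℝ), IsCube Q → ∀ p : ℝ, 1 ≤ p →
        weightedLpRatio w f p Q ≤ ENNReal.ofReal c * ainftyConst w * ENNReal.ofReal p) ∧
    (∃ c : ℝ, 0 < c ∧
      ∀ w : (Fin n → ℝ) → ℝ, IsWeight w → ∀ C : ℝ, 0 ≤ C →
      (∀ f : (Fin n → ℝ) → ℝ, IsAdmissible f →
        ∀ p : ℝ, 1 ≤ p → ∀ Q : Set (Fin n → ℝ), IsCube Q →
          weightedLpRatio w f p Q ≤ ENNReal.ofReal C * ENNReal.ofReal p) →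
      IsAinfty w ∧ ainftyConst w ≤ ENNReal.ofReal c * ENNReal.ofReal C) := by
  refine ⟨⟨(((6 ^ n + 3 ^ n + 2 ^ n + 3) * 4 : ℕ) : ℝ), by positivity, ?_⟩,
    ⟨(((2 + 4 * 4 ^ n * (4 * 16 ^ n)) * (4 * 16 ^ n) +
      4 * 4 ^ n * (2 * (2 * n + 2 * 3 ^ n)) : ℕ) : ℝ), by positivity, ?_⟩⟩
  · rintro w hw - f hf _ ⟨a, r, hr, rfl⟩ p hp
    refine (weightedLpRatio_le hw hf.locallyIntegrable a hr hp).trans (le_of_eq ?_)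
    rw [ENNReal.ofReal_natCast]
    push_cast
    ring
  · intro w hw C _ h
    have hle := ainftyConst_le_of_forall hn hw (D := ENNReal.ofReal C) fun f hf Q hQ => by
      simpa using h f hf 1 le_rfl Q hQ
    have hbound : ainftyConst w ≤ ENNReal.ofReal (((2 + 4 * 4 ^ n * (4 * 16 ^ n)) * (4 * 16 ^ n) +
        4 * 4 ^ n * (2 * (2 * n + 2 * 3 ^ n)) : ℕ) : ℝ) * ENNReal.ofReal C := by
      rw [ENNReal.ofReal_natCast]
      push_cast
      exact hle
    exact ⟨⟨hw, hbound.trans_lt (ENNReal.mul_lt_top ENNReal.ofReal_lt_top ENNReal.ofReal_lt_top)⟩,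
      hbound⟩
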